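/- **Conventions.** $\mathbb R^{1,2}$ is $\mathbb R^3$ with $\langle x,y\rangle=-x_0y_0+x_1y_1+x_2y_2$, and $x\boxtimes y$ is the vector with $\langle x\boxtimes y,v\rangle=\det(x,y,v)$ for all $v$. The hyperbolic plane $\mathbb H^2$ is the open unit disk $\mathbb D\subset\mathbb R^2=\mathbb C$ (Klein model); its geodesics are the open chords. For $\sigma\in\mathbb R^{1,2}$ let $\Lambda(\sigma)$ be the Killing field of $\mathbb D$ whose flow is $\eta\mapsto\Pi\big(e^{tM_\sigma}(1,\eta)\big)$, where $M_\sigma(y)=y\boxtimes\sigma$ and $\Pi(x_0,x_1,x_2)=(x_1/x_0,x_2/x_0)$; every Killing field is $\Lambda(\sigma)$ for exactly one $\sigma$. It is hyperbolic if $\langle\sigma,\sigma\rangle>0$, with axis $\{\eta\in\mathbb D:\langle(1,\eta),\sigma\rangle=0\}$. A geodesic lamination $\lambda$ is a closed subset of the space of unoriented geodesics whose elements (leaves) are pairwise disjoint. Its gaps are the connected components of the complement in $\mathbb D$ of the union of the leaves; its strata are its leaves and its gaps. A vector field $\mathcal E:\mathbb D\to\mathbb R^2$ (not assumed continuous) is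 a *left (right) infinitesimal earthquake along $\lambda$* if on each stratum $S$ it is the restriction of a Killing field $K_S$, and for any two strata $S,S'$ the comparison field $\mathfrak a=K_{S'}-K_S$ satisfies: $\mathfrak a\neq0$ unless $S$ and $S'$ are both contained in the closure of one stratum; and if $\mathfrak a\ne0$, then $\mathfrak a$ is hyperbolic, its axis weakly separates $S$ and $S'$ (they lie in opposite closed half-planes), and $\mathfrak a$ translates to the left (right) seen from $S$ to $S'$. The last condition means: for every smooth arc $c:[0,1]\to\mathbb D$ from $S$ to $S'$ that meets the axis at exactly one time $t_0$, and transversally there, $c'(t_0)$ followed by a vector tangent to the axis pointing from $c(t_0)$ in the direction of translation is a positive (negative) basis of $\mathbb R^2$. A field $\mathcal E$ on $\mathbb D$ *extends continuously to* a field $X$ on $\mathbb S^1$ if $\mathcal E(\eta_n)\to X(z)$ whenever $\eta_n\in\mathbb D$, $\eta_n\to z\in\mathbb S^1$. For a continuous tangent vector field $X$ on $\mathbb S^1$ write $X(z)=iz\,\phi_X(z)$ ($\phi_X$ is its support function), and let $\mathcal C(X)$ be the convex hull of the graph of $\phi_X$ in $\overline{\mathbb D}\times\mathbb R$, the closure of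 the Klein model $\mathbb D\times\mathbb R$ of Half-pipe space. For $\sigma\in\mathbb R^{1,2}$ let $P_\sigma=\{(\eta,t):t=\langle(1,\eta),\sigma\rangle\}$. Call $P_\sigma$ a *lower (upper) support plane over $\eta$* if $P_\sigma$ contains a point $(\eta,t)$ of $\mathcal C(X)$ and $\mathcal C(X)$ lies in the closed half-space above (below) $P_\sigma$. **Theorem 1.1.** Let $X$ be a continuous vector field on $\mathbb S^1$. Then there are a geodesic lamination $\lambda$ and a left infinitesimal earthquake $\mathcal E$ along $\lambda$ that extends continuously to $X$, such that: 1. For every $\eta\in\mathbb D$ the set of $\sigma$ for which $P_\sigma$ is a lower support plane over $\eta$ is a segment (possibly a single point), and $\mathcal E(\eta)=\Lambda(\sigma)(\eta)$ for the midpoint $\sigma$ of that segment. 2. (Uniqueness and range of choices.) Given a lamination $\lambda_1$ and a vector field $\mathcal E_1$ on $\mathbb D$, the field $\mathcal E_1$ is a left infinitesimal earthquake along $\lambda_1$ that extends continuously to $X$ if and only if: $\lambda_1=\lambda$; $\mathcal E_1=\mathcal E$ on all gaps of $\lambda$ and on all leaves at all of whose points $\mathcal E$ is continuous; and on each other leaf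 $\ell$ of $\lambda$ the field $\mathcal E_1$ equals $\Lambda(\sigma)$ for some $\sigma$ such that $P_\sigma$ is a lower support plane over every point of $\ell$. 3. For each leaf $\ell$ of $\lambda$ at some point of which $\mathcal E$ is discontinuous, the set of those $\sigma$ is a segment $[\sigma_1,\sigma_2]$ with $\sigma_1\neq\sigma_2$, where $\Lambda(\sigma_2-\sigma_1)$ is hyperbolic with axis $\ell$. The same holds with "right" and "upper" in place of "left" and "lower". -/

import Mathlib

open Set Filter Topology
open scoped ContDiff

noncomputable section

namespace InfEarthquake

/-! ### Minkowski space and the Klein disk -/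

/-- The underlying vector space of Minkowski space of signature (-,+,+). -/
abbrev Mink : Type := Fin 3 → ℝ

/-- The Lorentzian bilinear form. -/
def mink (x y : Mink) : ℝ := -(x 0 * y 0) + x 1 * y 1 + x 2 * y 2

/-- The Minkowski cross product: `mink (cross x y) v = det (x, y, v)` for all `v`. -/
def cross (x y : Mink) : Mink :=
  ![-(x 1 * y 2 - x 2 * y 1), x 2 * y 0 - x 0 * y 2, x 0 * y 1 - x 1 * y 0]

/-- The Klein model of the hyperbolic plane: the open unit disk of the plane `ℂ = ℝ²`. -/
def disk : Set ℂ := Metric.ball 0 1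

/-- The vector `(1, η)`. -/
def lift (η : ℂ) : Mink := ![1, η.re, η.im]

/-- The radial projection `(x₀, x₁, x₂) ↦ (x₁ / x₀, x₂ / x₀)`. -/
def proj (x : Mink) : ℂ := ⟨x 1 / x 0, x 2 / x 0⟩

/-! ### Killing fields -/

/-- The element `y ↦ cross y σ` of the Lie algebra of the isometry group of the hyperbolic plane;
every element of the Lie algebra is of this form for a unique `σ`. -/
def lieElem (σ : Mink) : Mink →L[ℝ] Mink :=
  LinearMap.toContinuousLinearMap
    { toFun := fun y => cross y σ
      map_add' := by
        intro x y
        ext i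
        fin_cases i <;> simp [cross] <;> ring
      map_smul' := by
        intro c x
        ext i
        fin_cases i <;> simp [cross] <;> ring }

/-- The one-parameter group of isometries generated by `σ`, acting on the Klein disk. -/
def flow (σ : Mink) (t : ℝ) (η : ℂ) : ℂ :=
  proj (NormedSpace.exp (t • lieElem σ) (lift η))

/-- The Killing vector field of the Klein disk generated by `σ`. -/
def killing (σ : Mink) (η : ℂ) : ℂ := deriv (fun t : ℝ => flow σ t η) 0

/-- The Killing field generated by `σ` is hyperbolic if `σ` is spacelike. -/
def IsHyperbolic (σ : Mink) : Prop := 0 < mink σ σ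

/-- The axis of a hyperbolic Killing field. -/
def axis (σ : Mink) : Set ℂ := {η | η ∈ disk ∧ mink (lift η) σ = 0}

/-- The axis of `σ` weakly separates `S` and `S'`: these lie in opposite closed half-planes. -/
def WeaklySeparates (σ : Mink) (S S' : Set ℂ) : Prop :=
  ((∀ η ∈ S, mink (lift η) σ ≤ 0) ∧ ∀ η ∈ S', 0 ≤ mink (lift η) σ) ∨
  ((∀ η ∈ S, 0 ≤ mink (lift η) σ) ∧ ∀ η ∈ S', mink (lift η) σ ≤ 0)

/-! ### Left and right -/

inductive Side : Type
  | left
  | right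

def Side.sign : Side → ℝ
  | .left => 1
  | .right => -1

/-- The standard area form of the plane; `(v, w)` is a positive basis if this is positive. -/
def area (v w : ℂ) : ℝ := v.re * w.im - v.im * w.re

/-- The isometries `flow σ τ`, `τ > 0`, translate to the left (right), seen from `S` to `S'`.
For each smooth arc `c` in the disk from a point of `S` to a point of `S'` that meets the axis
at exactly one time `t₀`, and transversally there, the vectors `v = c'(t₀)` and `w` form a positive
(negative) basis, where `w` is tangent to the axis and points from `c t₀` to its image under
`flow σ τ` (geodesics of the Klein model are straight). -/
def Translates (s : Side) (σ : Mink) (S S' : Set ℂ) : Prop :=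
  ∀ c : ℝ → ℂ, ContDiffOn ℝ ∞ c (Icc 0 1) → (∀ t ∈ Icc (0 : ℝ) 1, c t ∈ disk) →
    c 0 ∈ S → c 1 ∈ S' →
    ∀ t₀ ∈ Icc (0 : ℝ) 1, (∀ t ∈ Icc (0 : ℝ) 1, c t ∈ axis σ ↔ t = t₀) →
    ∀ v w : ℂ, v = derivWithin c (Icc 0 1) t₀ →
    ∀ τ : ℝ, 0 < τ → w = flow σ τ (c t₀) - c t₀ →
    area v w ≠ 0 → 0 < s.sign * area v w

/-! ### Geodesic laminations -/

/-- Two ordered pairs of distinct points of the circle span the same unoriented geodesic. -/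
def geodesicSetoid : Setoid {p : Circle × Circle // p.1 ≠ p.2} where
  r p q := p.1 = q.1 ∨ p.1 = q.1.swap
  iseqv :=
    { refl := fun _ => Or.inl rfl
      symm := by
        rintro p q (h | h)
        · exact Or.inl h.symm
        · exact Or.inr (by rw [h, Prod.swap_swap])
      trans := by
        rintro p q r (h | h) (h' | h')
        · exact Or.inl (h.trans h')
        · exact Or.inr (h.trans h')
        · exact Or.inr (by rw [h, h'])
        · exact Or.inl (by rw [h, h', Prod.swap_swap]) }

/-- The space of unoriented complete geodesics of the hyperbolic plane, with the quotient
topology. -/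
def Geodesic : Type := Quotient geodesicSetoid

instance : TopologicalSpace Geodesic :=
  inferInstanceAs (TopologicalSpace (Quotient geodesicSetoid))

/-- The set of points of a geodesic: the open chord between its ideal endpoints. -/
def Geodesic.carrier (l : Geodesic) : Set ℂ :=
  Quotient.lift (s := geodesicSetoid)
    (fun p : {p : Circle × Circle // p.1 ≠ p.2} => openSegment ℝ (p.1.1 : ℂ) (p.1.2 : ℂ))
    (by
      rintro ⟨⟨a, b⟩, _⟩ ⟨⟨c, d⟩, _⟩ (h | h)
      · obtain ⟨rfl, rfl⟩ := Prod.mk.inj h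
        rfl
      · obtain ⟨rfl, rfl⟩ := Prod.mk.inj h
        exact openSegment_symm ℝ _ _) l

/-- A geodesic lamination: a closed set of pairwise disjoint complete geodesics. -/
def IsLamination (L : Set Geodesic) : Prop :=
  IsClosed L ∧ L.PairwiseDisjoint Geodesic.carrier

/-- The union of the leaves. -/
def locus (L : Set Geodesic) : Set ℂ := ⋃ l ∈ L, l.carrier

/-- The gaps: the connected components of the complement of the union of the leaves. -/
def IsGap (L : Set Geodesic) (G : Set ℂ) : Prop :=
  ∃ η ∈ disk \ locus L, G = connectedComponentIn (disk \ locus L) η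

/-- The strata: the leaves and the gaps. -/
def IsStratum (L : Set Geodesic) (S : Set ℂ) : Prop :=
  (∃ l ∈ L, S = l.carrier) ∨ IsGap L S

/-! ### Infinitesimal earthquakes -/

/-- `E` is a left (right) infinitesimal earthquake along the lamination `L`. The vector `κ S`
generates the Killing field that agrees with `E` on the stratum `S` (it is unique), so
`κ S' - κ S` generates the comparison vector field of `S` and `S'`. -/
def IsInfEarthquake (s : Side) (L : Set Geodesic) (E : disk → ℂ) : Prop :=
  ∃ κ : Set ℂ → Mink,
    (∀ S, IsStratum L S → ∀ η : disk, (η : ℂ) ∈ S → E η = killing (κ S) η) ∧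
    ∀ S S', IsStratum L S → IsStratum L S' →
      (κ S' - κ S = 0 → ∃ T, IsStratum L T ∧ S ⊆ closure T ∧ S' ⊆ closure T) ∧
      (κ S' - κ S ≠ 0 →
        IsHyperbolic (κ S' - κ S) ∧ WeaklySeparates (κ S' - κ S) S S' ∧
          Translates s (κ S' - κ S) S S')

/-- The vector field `E` on the disk extends continuously to `X` on the circle. -/
def ExtendsTo (E : disk → ℂ) (X : Circle → ℂ) : Prop :=
  ∀ z : Circle, Tendsto E (comap (fun η : disk => (η : ℂ)) (𝓝 (z : ℂ))) (𝓝 (X z))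

/-- `X` is a vector field on the circle, i.e. tangent to the circle. -/
def IsTangent (X : Circle → ℂ) : Prop := ∀ z : Circle, inner ℝ (z : ℂ) (X z) = 0

/-! ### The convex hull in Half-pipe space, in its Klein model `disk × ℝ` -/

/-- The support function: `X z = i z * supportFun X z` for a tangent field `X`. -/
def supportFun (X : Circle → ℂ) (z : Circle) : ℝ := inner ℝ (Complex.I * (z : ℂ)) (X z)

/-- The convex hull of the graph of the support function. -/
def hull (X : Circle → ℂ) : Set (ℂ × ℝ) :=
  convexHull ℝ (range fun z : Circle => ((z : ℂ), supportFun X z))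

/-- The spacelike (non-vertical) plane dual to `σ`. -/
def dualPlane (σ : Mink) : Set (ℂ × ℝ) := {p | mink (lift p.1) σ = p.2}

/-- The plane dual to `σ` is a support plane of the hull at the point over `η` of the lower boundary
(for `left`: the hull lies above the plane) or of the upper boundary (for `right`). -/
def IsSupportPlane (s : Side) (X : Circle → ℂ) (η : ℂ) (σ : Mink) : Prop :=
  (∃ t : ℝ, (η, t) ∈ dualPlane σ ∩ hull X) ∧
    ∀ p ∈ hull X, 0 ≤ s.sign * (p.2 - mink (lift p.1) σ)

/-- The plane dual to `σ` is the medial support plane over `η`: the support planes form a segment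
(possibly one point), and `σ` is its midpoint. -/
def IsMedialSupportPlane (s : Side) (X : Circle → ℂ) (η : ℂ) (σ : Mink) : Prop :=
  ∃ σ₁ σ₂ : Mink, {ρ | IsSupportPlane s X η ρ} = segment ℝ σ₁ σ₂ ∧ σ = midpoint ℝ σ₁ σ₂

/-- The vectors whose dual planes are support planes along the whole leaf `l`. -/
def leafSupport (s : Side) (X : Circle → ℂ) (l : Geodesic) : Set Mink :=
  {σ | ∀ η ∈ l.carrier, IsSupportPlane s X η σ}

/-- `E` is continuous at all points of the geodesic `l`. -/
def ContinuousAlong (E : disk → ℂ) (l : Geodesic) : Prop :=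
  ∀ η : disk, (η : ℂ) ∈ l.carrier → ContinuousAt E η

end InfEarthquake

end

open InfEarthquake

namespace InfEarthquake

/-! ### Affine functions and Killing fields -/

/-! Multiplying by the sign of the side turns upper support planes into lower ones, so both cases
become one statement about the lower convex envelope `env` of a continuous function φ on the circle,
namely the signed support function `bd s X`. Up to a rotation by a right angle, the Killing field of
σ at η is (1 - |η|²)∇u + u(η)η, where u is the affine function `aff s σ` (`killing_eq`). Choosing a
support plane at every point therefore gives a vector field that records the value and a subgradient
of the envelope.

Existence: a support plane at η touches φ on a set of circle points whose convex hull contains η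
(`exists_supp`). Hence η lies on a chord between contact points or in the interior of that hull
(`exists_contact_or_mem_interior`). The open regions where the envelope is affine are the gaps, and
the remaining chords form the lamination `bending`. A support plane of a stratum is maximal there
among all affine functions below φ, so the difference of two of them changes sign in the right
direction between their strata. This is the separation and translation condition
(`Adapted.isInfEarthquake`). Affine barriers show that the value tends to φ and that (1 - |η|)|∇u|
tends to 0 at the circle, which gives the continuous extension (`tendsto_normalField`).

Uniqueness: for any earthquake with boundary field X, the comparison conditions say that its affine
functions are dominated by the one belonging to each stratum. Their maximum v is convex; it has
boundary values φ (`tendsto_of_tendsto_normalField`) and coincides with the envelope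
(`env_le_of_stratified`). So the Killing fields come from support planes, and the clause on nonzero
comparison fields forces the lamination to be `bending` (`disjoint_flatPart_of_mem`). What is left
free is the support plane on each leaf. The candidates form a segment, because any two agree at both
ends of the leaf, and the segment is a point exactly when the field is continuous
(`eq_of_continuousAt`, `continuousAt_of_forall_eq`). -/

theorem Side.sign_mul_self (s : Side) : s.sign * s.sign = 1 := by cases s <;> simp [Side.sign]

theorem Side.sign_ne_zero (s : Side) : s.sign ≠ 0 := by cases s <;> simp [Side.sign]

/-- The affine function on the plane whose graph is the plane dual to `σ`, up to the sign of the
side. -/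
def aff (s : Side) (σ : Mink) (η : ℂ) : ℝ := s.sign * mink (lift η) σ

/-- The gradient of `aff s σ`. -/
def grad (s : Side) (σ : Mink) : ℂ := ⟨s.sign * σ 1, s.sign * σ 2⟩

theorem aff_eq (s : Side) (σ : Mink) (η : ℂ) :
    aff s σ η = s.sign * (-σ 0 + η.re * σ 1 + η.im * σ 2) := by
  simp [aff, mink, lift]

theorem aff_eq_add (s : Side) (σ : Mink) (η ζ : ℂ) :
    aff s σ ζ = aff s σ η + inner ℝ (grad s σ) (ζ - η) := by
  simp [aff_eq, grad, Complex.inner]; ring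

theorem aff_sub (s : Side) (σ τ : Mink) (η : ℂ) : aff s (σ - τ) η = aff s σ η - aff s τ η := by
  simp [aff_eq]; ring

theorem aff_smul (s : Side) (c : ℝ) (τ : Mink) (η : ℂ) : aff s (c • τ) η = c * aff s τ η := by
  simp [aff_eq]; ring

theorem aff_add (s : Side) (σ τ : Mink) (η : ℂ) : aff s (σ + τ) η = aff s σ η + aff s τ η := by
  simp [aff_eq]; ring

theorem aff_combo (s : Side) (σ : Mink) {x y : ℂ} {a b : ℝ} (h : a + b = 1) :
    aff s σ (a • x + b • y) = a * aff s σ x + b * aff s σ y := by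
  obtain rfl : b = 1 - a := by linarith
  simp [aff_eq]; ring

theorem aff_eq_zero_iff (s : Side) (σ : Mink) (η : ℂ) : aff s σ η = 0 ↔ mink (lift η) σ = 0 := by
  simp [aff, s.sign_ne_zero]

theorem continuous_aff (s : Side) : Continuous fun p : Mink × ℂ => aff s p.1 p.2 := by
  simp only [aff_eq]
  have := Complex.continuous_re
  have := Complex.continuous_im
  fun_prop

theorem continuous_aff_right (s : Side) (σ : Mink) : Continuous (aff s σ) :=
  (continuous_aff s).comp (by fun_prop : Continuous fun η : ℂ => (σ, η))

theorem continuous_aff_left (s : Side) (η : ℂ) : Continuous fun σ => aff s σ η :=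
  (continuous_aff s).comp (by fun_prop : Continuous fun σ : Mink => (σ, η))

theorem continuous_grad (s : Side) : Continuous (grad s) := by
  have : grad s = fun σ => ((s.sign * σ 1 : ℝ) : ℂ) + ((s.sign * σ 2 : ℝ) : ℂ) * Complex.I := by
    funext σ; apply Complex.ext <;> simp [grad]
  rw [this]; fun_prop

theorem mem_disk {η : ℂ} : η ∈ disk ↔ ‖η‖ < 1 := by simp [disk]

theorem mem_disk_iff {η : ℂ} : η ∈ disk ↔ η.re ^ 2 + η.im ^ 2 < 1 := by
  rw [mem_disk, ← sq_lt_one_iff₀ (norm_nonneg _), Complex.sq_norm, Complex.normSq_apply]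
  ring_nf

theorem isOpen_disk : IsOpen disk := Metric.isOpen_ball

theorem convex_disk : Convex ℝ disk := convex_ball _ _

theorem circle_sq (z : Circle) : (z : ℂ).re ^ 2 + (z : ℂ).im ^ 2 = 1 := by
  have := z.normSq_coe
  rw [Complex.normSq_apply] at this; linarith

theorem circle_notMem_disk (z : Circle) : (z : ℂ) ∉ disk := by
  simp [mem_disk, -not_lt, Circle.norm_coe]

theorem eq_zero_of_grad_eq_zero {s : Side} {σ : Mink} {η : ℂ} (hg : grad s σ = 0)
    (h : aff s σ η = 0) : σ = 0 := by
  have h1 := congrArg Complex.re hg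
  have h2 := congrArg Complex.im hg
  simp only [grad, Complex.zero_re, Complex.zero_im, mul_eq_zero, s.sign_ne_zero, false_or] at h1 h2
  rw [aff_eq, h1, h2] at h
  simp [s.sign_ne_zero] at h
  ext i
  fin_cases i <;> simp [*]

/-- An affine function with a local maximum of value zero vanishes. -/
theorem eq_zero_of_aff_nonpos {s : Side} {σ : Mink} {η : ℂ} (h0 : aff s σ η = 0)
    (h : ∀ᶠ ζ in 𝓝 η, aff s σ ζ ≤ 0) : σ = 0 := by
  refine eq_zero_of_grad_eq_zero ?_ h0
  have ht : Tendsto (fun t : ℝ => η + t • grad s σ) (𝓝[>] 0) (𝓝 η) := by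
    have : Continuous fun t : ℝ => η + t • grad s σ := by fun_prop
    simpa using (this.tendsto 0).mono_left nhdsWithin_le_nhds
  obtain ⟨t, ht, htp⟩ := ((ht.eventually h).and self_mem_nhdsWithin).exists
  rw [aff_eq_add s σ η, h0, add_sub_cancel_left, inner_smul_right, real_inner_self_eq_norm_sq,
    zero_add] at ht
  have : ‖grad s σ‖ ^ 2 ≤ 0 := by
    by_contra! hc
    exact absurd ht (not_le.2 (mul_pos htp hc))
  simpa using this

theorem hasDerivAt_flow_zero (σ : Mink) (η : ℂ) :
    HasDerivAt (fun t : ℝ => flow σ t η)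
      ⟨cross (lift η) σ 1 - η.re * cross (lift η) σ 0,
        cross (lift η) σ 2 - η.im * cross (lift η) σ 0⟩ 0 := by
  have h := hasDerivAt_exp_smul_const (𝕂 := ℝ) (lieElem σ) 0
  have h' : HasDerivAt (fun t : ℝ => NormedSpace.exp (t • lieElem σ) (lift η))
      (cross (lift η) σ) 0 := by
    have := h.clm_apply (hasDerivAt_const (0 : ℝ) (lift η))
    simpa [lieElem] using this
  have hc := hasDerivAt_pi.1 h'
  have e0 : (NormedSpace.exp ((0 : ℝ) • lieElem σ)) (lift η) = lift η := by simp
  have q (i : Fin 3) := (hc i).div (hc 0) (by rw [e0]; simp [lift])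
  have := (q 1).ofReal_comp.add ((q 2).ofReal_comp.mul_const Complex.I)
  simp only [e0] at this
  refine (this.congr_deriv ?_).congr_of_eventuallyEq (Eventually.of_forall fun t => ?_)
  rotate_left
  · apply Complex.ext <;> simp [flow, proj]
  · apply Complex.ext <;> simp [lift, -Complex.ofReal_mul, -Complex.ofReal_sub]

/-- This links the two pictures: the field at η encodes the first-order jet of the affine function
at η, so once the value is known the field determines the gradient. -/
theorem killing_eq (s : Side) (σ : Mink) (η : ℂ) :
    killing σ η = s.sign • (Complex.I *
      ((1 - ‖η‖ ^ 2 : ℝ) * grad s σ + (aff s σ η : ℝ) * η)) := by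
  rw [killing, (hasDerivAt_flow_zero σ η).deriv, Complex.sq_norm, Complex.normSq_apply]
  have := s.sign_mul_self
  apply Complex.ext
  · simp [cross, lift, grad, aff_eq]; linear_combination (-1 : ℝ) * (η.im * σ 0 - σ 2 + η.re * (η.re * σ 2 - η.im * σ 1)) * this
  · simp [cross, lift, grad, aff_eq]; linear_combination (-1 : ℝ) * (-η.re * σ 0 + σ 1 + η.im * (η.re * σ 2 - η.im * σ 1)) * this

theorem exp_apply_eigenvector (T : Mink →L[ℝ] Mink) (μ : ℝ) (v : Mink) (h : T v = μ • v) :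
    NormedSpace.exp T v = Real.exp μ • v := by
  have h1 := (NormedSpace.exp_series_hasSum_exp' (𝕂 := ℝ) T).mapL
    (ContinuousLinearMap.apply ℝ Mink v)
  have h2 := (NormedSpace.exp_series_hasSum_exp' (𝕂 := ℝ) μ).smul_const v
  rw [← Real.exp_eq_exp_ℝ] at h2
  have hp : ∀ n : ℕ, (T ^ n) v = μ ^ n • v := by
    intro n
    induction n with
    | zero => simp
    | succ n ih => rw [pow_succ', mul_apply_eq_comp, ih, map_smul, h, smul_smul, pow_succ]
  refine h1.unique ?_
  have he : (fun n : ℕ => ContinuousLinearMap.apply ℝ Mink v ((n.factorial : ℝ)⁻¹ • T ^ n)) =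
      fun n : ℕ => ((n.factorial : ℝ)⁻¹ • μ ^ n) • v := by
    funext n
    simp [hp, smul_smul]
  rw [he]
  exact h2

/-- On its axis, a hyperbolic isometry moves points in the direction of its Killing field. -/
theorem flow_sub_self {σ : Mink} (hσ : IsHyperbolic σ) {η : ℂ} (hη : η ∈ axis σ) {τ : ℝ}
    (hτ : 0 < τ) : ∃ k : ℝ, 0 < k ∧ flow σ τ η - η = k • (Complex.I * ⟨σ 1, σ 2⟩) := by
  obtain ⟨hd, h0⟩ := hη
  rw [mem_disk_iff] at hd
  set r := Real.sqrt (mink σ σ) with hr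
  have hrp : 0 < r := Real.sqrt_pos.2 hσ
  have hr2 : r * r = mink σ σ := Real.mul_self_sqrt hσ.le
  have hs : σ 0 = η.re * σ 1 + η.im * σ 2 := by simp [mink, lift] at h0; linarith
  set y := lift η with hy
  set m := cross y σ with hm
  have hM : ∀ x, lieElem σ x = cross x σ := fun x => rfl
  have hmm : lieElem σ m = (r * r) • y := by
    rw [hr2, hM]
    ext i
    fin_cases i <;> simp [hm, hy, cross, lift, mink] <;> rw [hs] <;> ring
  -- Since ⟨y, σ⟩ = 0, the square of `lieElem σ` acts on y as r². So r y ± m are eigenvectors for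
  -- ±r, and the flow on their plane is explicit.
  have e1 := exp_apply_eigenvector (τ • lieElem σ) (τ * r) (r • y + m) (by
    simp only [smul_apply, map_add, map_smul, hmm]
    rw [hM y, ← hm]; module)
  have e2 := exp_apply_eigenvector (τ • lieElem σ) (τ * -r) (r • y - m) (by
    simp only [smul_apply, map_sub, map_smul, hmm]
    rw [hM y, ← hm]; module)
  set A := Real.exp (τ * r) with hA
  set B := Real.exp (τ * -r) with hB
  have hBA : B < A := Real.exp_lt_exp.2 (by nlinarith)
  have hBp : 0 < B := Real.exp_pos _
  have e3 : NormedSpace.exp (τ • lieElem σ) y = ((A + B) / 2) • y + ((A - B) / (2 * r)) • m := by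
    have : y = (1 / (2 * r)) • ((r • y + m) + (r • y - m)) := by
      have : (1 / (2 * r)) * (r + r) = 1 := by field_simp; norm_num
      rw [show (r • y + m) + (r • y - m) = (r + r) • y by module, smul_smul, this, one_smul]
    rw [this, map_smul, map_add, e1, e2, ← this]
    ext i
    simp; field_simp; ring
  have hm0 : m 0 = -(η.re * σ 2 - η.im * σ 1) := by simp [hm, hy, cross, lift]
  -- With g = (σ₁, σ₂), Lagrange's identity gives m₀² + σ₀² = |η|²|g|² < |g|². This keeps the time
  -- coordinate D of the image positive.
  have hlt : m 0 ^ 2 < r ^ 2 := by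
    rw [hm0, sq r, hr2]
    have : 0 < mink σ σ := hσ
    simp only [mink, hs] at this ⊢
    nlinarith [mul_nonneg (sub_nonneg.2 hd.le) (add_nonneg (sq_nonneg (σ 1)) (sq_nonneg (σ 2))),
      sq_nonneg (η.re * σ 1 + η.im * σ 2), sq_nonneg (η.re * σ 2 - η.im * σ 1)]
  have habs := abs_lt_of_sq_lt_sq' hlt hrp.le
  set D := (A + B) / 2 + (A - B) / (2 * r) * m 0 with hD
  have hDp : 0 < D := by
    have : (A - B) / (2 * r) * m 0 ≥ (A - B) / (2 * r) * (-r) :=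
      mul_le_mul_of_nonneg_left habs.1.le (by have := sub_pos.2 hBA; positivity)
    have h2 : (A - B) / (2 * r) * (-r) = -(A - B) / 2 := by field_simp
    rw [hD]; linarith
  set C := (A - B) / (2 * r) with hC
  refine ⟨C * (1 - η.re ^ 2 - η.im ^ 2) / D, ?_, ?_⟩
  · have := sub_pos.2 hBA
    have : 0 < 1 - η.re ^ 2 - η.im ^ 2 := by linarith
    positivity
  · have f0 : (NormedSpace.exp (τ • lieElem σ) y) 0 = D := by
      rw [e3]; simp [hD, hy, lift]
    have f1 : (NormedSpace.exp (τ • lieElem σ) y) 1 = (A + B) / 2 * η.re + C * m 1 := by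
      rw [e3]; simp [hy, lift]
    have f2 : (NormedSpace.exp (τ • lieElem σ) y) 2 = (A + B) / 2 * η.im + C * m 2 := by
      rw [e3]; simp [hy, lift]
    have hm1 : m 1 = η.im * σ 0 - σ 2 := by simp [hm, hy, cross, lift]
    have hm2 : m 2 = σ 1 - η.re * σ 0 := by simp [hm, hy, cross, lift]
    rw [flow, proj, f0, f1, f2, hm1, hm2]
    apply Complex.ext
    · rw [Complex.smul_re]
      simp only [Complex.sub_re, Complex.mul_re, Complex.I_re, Complex.I_im, smul_eq_mul]
      rw [div_sub' hDp.ne', div_eq_iff hDp.ne', mul_right_comm, div_mul_cancel₀ _ hDp.ne', hD, hm0,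
        hs]
      ring
    · rw [Complex.smul_im]
      simp only [Complex.sub_im, Complex.mul_im, Complex.I_re, Complex.I_im, smul_eq_mul]
      rw [div_sub' hDp.ne', div_eq_iff hDp.ne', mul_right_comm, div_mul_cancel₀ _ hDp.ne', hD, hm0,
        hs]
      ring

end InfEarthquake

/-! ### Direction of translation and signs of affine functions -/

namespace InfEarthquake

/-- For η in the disk the vector (1, η) is timelike, and the orthogonal complement of a timelike
vector is spacelike. -/
theorem isHyperbolic_of_mink_lift_eq_zero {σ : Mink} (hσ : σ ≠ 0) {η : ℂ} (hη : η ∈ disk)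
    (h : mink (lift η) σ = 0) : IsHyperbolic σ := by
  rw [mem_disk_iff] at hη
  have h0 : σ 0 = η.re * σ 1 + η.im * σ 2 := by simp [mink, lift] at h; linarith
  have hg : 0 < σ 1 ^ 2 + σ 2 ^ 2 := by
    by_contra! hc
    have h1 : σ 1 = 0 := by nlinarith [sq_nonneg (σ 1), sq_nonneg (σ 2)]
    have h2 : σ 2 = 0 := by nlinarith [sq_nonneg (σ 1), sq_nonneg (σ 2)]
    refine hσ (funext fun i => ?_)
    fin_cases i <;> simp [h0, h1, h2]
  simp only [IsHyperbolic, mink, h0]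
  nlinarith [mul_pos (sub_pos.2 hη) hg, sq_nonneg (η.re * σ 2 - η.im * σ 1)]

/-- Converts the orientation test in `Translates` into the sign of the derivative of `aff s σ` along
the arc. -/
theorem sign_mul_area (s : Side) (σ : Mink) (v : ℂ) (k : ℝ) :
    s.sign * area v (k • (Complex.I * ⟨σ 1, σ 2⟩)) = k * inner ℝ (grad s σ) v := by
  simp [area, grad, Complex.inner]; ring

/-- Along the arc the affine function goes from ≤ 0 to ≥ 0 and vanishes only at t₀. A negative
derivative there would force a second zero by the intermediate value theorem. -/
theorem translates_of_nonpos_of_nonneg {s : Side} {σ : Mink} (hσ : IsHyperbolic σ) {S S' : Set ℂ}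
    (hS : ∀ η ∈ S, aff s σ η ≤ 0) (hS' : ∀ η ∈ S', 0 ≤ aff s σ η) : Translates s σ S S' := by
  intro c hc hcd h0 h1 t₀ ht₀ hmeet v w hv τ hτ hw hne
  have hax : c t₀ ∈ axis σ := (hmeet t₀ ht₀).2 rfl
  obtain ⟨k, hk, hfl⟩ := flow_sub_self hσ hax hτ
  rw [hw, hfl] at hne ⊢
  rw [sign_mul_area]
  have hne' : inner ℝ (grad s σ) v ≠ 0 := by
    intro h
    have := sign_mul_area s σ v k
    rw [h, mul_zero, mul_eq_zero] at this
    exact this.elim s.sign_ne_zero hne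
  refine mul_pos hk (hne'.lt_or_gt.resolve_left fun hneg => ?_)
  set f : ℝ → ℝ := fun t => aff s σ (c t) with hf
  have hfc : ContinuousOn f (Icc 0 1) :=
    (continuous_aff_right s σ).comp_continuousOn hc.continuousOn
  have hf0 : f t₀ = 0 := (aff_eq_zero_iff s σ _).2 hax.2
  have hzero : ∀ t ∈ Icc (0 : ℝ) 1, f t = 0 → t = t₀ := fun t ht h =>
    (hmeet t ht).1 ⟨hcd t ht, (aff_eq_zero_iff s σ _).1 h⟩
  have hd : HasDerivWithinAt f (inner ℝ (grad s σ) v) (Icc 0 1) t₀ := by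
    have h1 : HasDerivWithinAt c v (Icc 0 1) t₀ := by
      rw [hv]; exact ((hc.differentiableOn (by simp)) t₀ ht₀).hasDerivWithinAt
    have h2 : HasDerivWithinAt (fun t => innerSL ℝ (grad s σ) (c t)) (inner ℝ (grad s σ) v)
        (Icc 0 1) t₀ := ((innerSL ℝ (grad s σ)).hasFDerivAt (x := c t₀)).comp_hasDerivWithinAt t₀ h1
    have hfe : f = fun t => innerSL ℝ (grad s σ) (c t) + aff s σ 0 := by
      funext t
      simp [hf, aff_eq_add s σ 0 (c t), add_comm]
    rw [hfe]
    exact h2.add_const _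
  have hsl := (hasDerivWithinAt_iff_tendsto_slope.1 hd).eventually (gt_mem_nhds hneg)
  -- The crossing may occur at an end of the arc: the second zero is sought after t₀ when there is
  -- room, and before it when t₀ = 1.
  rcases ht₀.2.lt_or_eq with hlt | rfl
  · have hev : ∀ᶠ t in 𝓝[Ioo t₀ 1] t₀, slope f t₀ t < 0 := by
      refine hsl.filter_mono (nhdsWithin_mono _ fun t ht => ?_)
      exact ⟨⟨ht₀.1.trans ht.1.le, ht.2.le⟩, ht.1.ne'⟩
    have : (𝓝[Ioo t₀ 1] t₀).NeBot := left_nhdsWithin_Ioo_neBot hlt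
    obtain ⟨t, ht, htm⟩ := (hev.and self_mem_nhdsWithin).exists
    have hft : f t < 0 := by
      rw [slope_def_field, hf0, sub_zero, div_neg_iff] at ht
      rcases ht with ⟨_, h⟩ | ⟨h, _⟩
      · linarith [htm.1]
      · exact h
    obtain ⟨u, hu, hu0⟩ := intermediate_value_Icc htm.2.le
      (hfc.mono (Icc_subset_Icc_left (ht₀.1.trans htm.1.le))) ⟨hft.le, hS' _ h1⟩
    have := hzero u ⟨(ht₀.1.trans htm.1.le).trans hu.1, hu.2⟩ hu0
    linarith [hu.1, htm.1]
  · have hev : ∀ᶠ t in 𝓝[Ioo 0 1] (1 : ℝ), slope f 1 t < 0 := by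
      refine hsl.filter_mono (nhdsWithin_mono _ fun t ht => ?_)
      exact ⟨⟨ht.1.le, ht.2.le⟩, ht.2.ne⟩
    have : (𝓝[Ioo (0 : ℝ) 1] 1).NeBot := right_nhdsWithin_Ioo_neBot one_pos
    obtain ⟨t, ht, htm⟩ := (hev.and self_mem_nhdsWithin).exists
    have hft : 0 < f t := by
      rw [slope_def_field, hf0, sub_zero, div_neg_iff] at ht
      rcases ht with ⟨h, _⟩ | ⟨_, h⟩
      · exact h
      · linarith [htm.2]
    obtain ⟨u, hu, hu0⟩ := intermediate_value_Icc htm.1.le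
      (hfc.mono (Icc_subset_Icc_right htm.2.le)) ⟨hS _ h0, hft.le⟩
    have := hzero u ⟨hu.1, hu.2.trans htm.2.le⟩ hu0
    linarith [hu.2, htm.2]

theorem weaklySeparates_of_nonpos_of_nonneg {s : Side} {σ : Mink} {S S' : Set ℂ}
    (hS : ∀ η ∈ S, aff s σ η ≤ 0) (hS' : ∀ η ∈ S', 0 ≤ aff s σ η) : WeaklySeparates σ S S' := by
  cases s
  · left; simpa [aff, Side.sign] using And.intro hS hS'
  · right; simpa [aff, Side.sign] using And.intro hS hS'

theorem WeaklySeparates.aff_cases {s : Side} {σ : Mink} {S S' : Set ℂ}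
    (h : WeaklySeparates σ S S') :
    ((∀ η ∈ S, aff s σ η ≤ 0) ∧ ∀ η ∈ S', 0 ≤ aff s σ η) ∨
      ((∀ η ∈ S, 0 ≤ aff s σ η) ∧ ∀ η ∈ S', aff s σ η ≤ 0) := by
  cases s
  · simpa [aff, Side.sign, WeaklySeparates] using h
  · simpa [aff, Side.sign, WeaklySeparates] using Or.symm h

/-- Straight segments suffice as test arcs: with the signs reversed, a segment along which the
function strictly decreases would cross the axis in the forbidden direction. -/
theorem Translates.nonpos_and_nonneg {s : Side} {σ : Mink} {S S' : Set ℂ} (h : Translates s σ S S')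
    (hσ : IsHyperbolic σ) (hw : WeaklySeparates σ S S') (hSd : S ⊆ disk) (hSd' : S' ⊆ disk)
    (hSn : S.Nonempty) (hSn' : S'.Nonempty) :
    (∀ η ∈ S, aff s σ η ≤ 0) ∧ ∀ η ∈ S', 0 ≤ aff s σ η := by
  rcases hw.aff_cases (s := s) with hw | ⟨h1, h2⟩
  · exact hw
  have key : ∀ x ∈ S, ∀ y ∈ S', ¬ aff s σ y < aff s σ x := by
    intro x hx y hy hlt
    have ha := h1 x hx
    have hb := h2 y hy
    set a := aff s σ x with haa
    set b := aff s σ y with hbb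
    set c : ℝ → ℂ := fun t => x + t • (y - x) with hc
    have hca : ∀ t, aff s σ (c t) = a + t * (b - a) := by
      intro t
      have e : c t = (1 - t) • x + t • y := by rw [hc]; module
      rw [e, aff_combo s σ (by ring)]; ring
    have hab : 0 < a - b := sub_pos.2 hlt
    have hcd : ∀ t ∈ Icc (0 : ℝ) 1, c t ∈ disk := fun t ht =>
      convex_disk.add_smul_sub_mem (hSd hx) (hSd' hy) ht
    have ht₀ : a / (a - b) ∈ Icc (0 : ℝ) 1 :=
      ⟨div_nonneg ha hab.le, (div_le_one hab).2 (by linarith)⟩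
    have hmeet : ∀ t ∈ Icc (0 : ℝ) 1, c t ∈ axis σ ↔ t = a / (a - b) := by
      intro t ht
      rw [axis, mem_ofPred_eq, ← aff_eq_zero_iff s, hca, eq_div_iff hab.ne']
      constructor
      · rintro ⟨-, h⟩; linarith
      · intro h; exact ⟨hcd t ht, by linarith⟩
    have hder : HasDerivAt c (y - x) (a / (a - b)) := by
      have := ((hasDerivAt_id (a / (a - b))).smul_const (y - x)).const_add x
      rwa [one_smul] at this
    obtain ⟨k, hk, hfl⟩ := flow_sub_self hσ ((hmeet _ ht₀).2 rfl) one_pos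
    have hsm : ContDiffOn ℝ ∞ c (Icc 0 1) := by
      have : ContDiff ℝ ∞ c := by rw [hc]; fun_prop
      exact this.contDiffOn
    have hneg : s.sign * area (y - x) (k • (Complex.I * ⟨σ 1, σ 2⟩)) < 0 := by
      rw [sign_mul_area]
      have := aff_eq_add s σ x y
      exact mul_neg_of_pos_of_neg hk (by linarith)
    have := h c hsm hcd (by simpa [hc] using hx) (by simpa [hc] using hy) _ ht₀ hmeet (y - x)
      (k • (Complex.I * ⟨σ 1, σ 2⟩))
      (hder.hasDerivWithinAt.derivWithin (uniqueDiffOn_Icc one_pos _ ht₀)).symm 1 one_pos hfl.symm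
      (fun h0 => by rw [h0, mul_zero] at hneg; exact hneg.false)
    exact this.not_gt hneg
  -- Without a strict decrease, the reversed separation makes the function vanish on both sets, so
  -- the claimed signs hold as well.
  obtain ⟨x, hx⟩ := hSn
  obtain ⟨y, hy⟩ := hSn'
  exact ⟨fun η hη => by linarith [not_lt.1 (key η hη y hy), h2 y hy],
    fun η hη => by linarith [not_lt.1 (key x hx η hη), h1 x hx]⟩

end InfEarthquake

namespace InfEarthquake

/-! ### Convex hulls -/

/-- By Carathéodory the hull is the continuous image of a simplex times K^N with N = dim E + 1;
shorter combinations are padded with weight zero. -/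
theorem isCompact_convexHull_of_isCompact {E : Type*} [NormedAddCommGroup E] [NormedSpace ℝ E]
    [FiniteDimensional ℝ E] {K : Set E} (hK : IsCompact K) : IsCompact (convexHull ℝ K) := by
  rcases K.eq_empty_or_nonempty with rfl | ⟨x₀, hx₀⟩
  · simp
  set N := Module.finrank ℝ E + 1
  let f : (Fin N → ℝ) × (Fin N → E) → E := fun p => ∑ i, p.1 i • p.2 i
  have hf : Continuous f := by fun_prop
  have himg : convexHull ℝ K = f '' (stdSimplex ℝ (Fin N) ×ˢ univ.pi fun _ => K) := by
    apply Subset.antisymm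
    · intro x hx
      obtain ⟨ι, _, z, w, hz, hi, hw, hw1, rfl⟩ := eq_pos_convex_span_of_mem_convexHull hx
      have hcard : Fintype.card ι ≤ Fintype.card (Fin N) := by
        rw [Fintype.card_fin]
        exact hi.card_le_finrank_succ.trans (Nat.succ_le_succ (Submodule.finrank_le _))
      obtain ⟨e⟩ := Function.Embedding.nonempty_of_card_le hcard
      have hext (i : ι) : Function.extend e w 0 (e i) = w i := e.injective.extend_apply _ _ _
      have hext' (i : ι) : Function.extend e z (fun _ => x₀) (e i) = z i :=
        e.injective.extend_apply _ _ _
      have hout : ∀ j ∉ range e, Function.extend e w 0 j = 0 := fun j hj =>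
        Function.extend_apply' _ _ _ (by simpa using hj)
      refine ⟨(Function.extend e w 0, Function.extend e z fun _ => x₀), ⟨⟨?_, ?_⟩, ?_⟩, ?_⟩
      · intro j
        by_cases hj : j ∈ range e
        · obtain ⟨i, rfl⟩ := hj
          simpa [hext] using (hw i).le
        · simp [hout j hj]
      · rw [← hw1]
        exact (Fintype.sum_of_injective e e.injective w _ hout fun i => (hext i).symm).symm
      · intro j _
        by_cases hj : j ∈ range e
        · obtain ⟨i, rfl⟩ := hj
          simpa [hext'] using hz ⟨i, rfl⟩
        · have : Function.extend e z (fun _ => x₀) j = x₀ :=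
            Function.extend_apply' _ _ _ (by simpa using hj)
          simpa [this] using hx₀
      · exact (Fintype.sum_of_injective e e.injective (fun i => w i • z i) _
          (fun j hj => by simp [hout j hj]) fun i => by simp [hext, hext']).symm
    · rintro _ ⟨⟨w, z⟩, ⟨hw, hz⟩, rfl⟩
      exact (convex_convexHull ℝ K).sum_mem (fun i _ => hw.1 i) hw.2
        fun i _ => subset_convexHull ℝ K (hz i trivial)
  rw [himg]
  exact ((isCompact_stdSimplex ℝ (Fin N)).prod (isCompact_univ_pi fun _ => hK)).image hf

theorem nonempty_interior_convexHull_triple {p q r : ℂ} (hp : ‖p‖ = 1) (hq : ‖q‖ = 1)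
    (hr : ‖r‖ = 1) (hpq : p ≠ q) (hpr : p ≠ r) (hqr : q ≠ r) :
    (interior (convexHull ℝ {p, q, r})).Nonempty := by
  rw [interior_convexHull_nonempty_iff_affineSpan_eq_top]
  have hc : EuclideanGeometry.Cospherical ({p, q, r} : Set ℂ) := by
    refine ⟨0, 1, ?_⟩
    simp [hp, hq, hr]
  have hi := hc.affineIndependent_of_ne hpq hpr hqr
  have := hi.affineSpan_eq_top_iff_card_eq_finrank_add_one.2 (by simp [Complex.finrank_real_complex])
  rwa [Matrix.range_cons, Matrix.range_cons, Matrix.range_cons, Matrix.range_empty, union_empty,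
    singleton_union, singleton_union] at this

/-- A point of the disk in the convex hull of a set of points of the circle lies on a chord or in
the interior. -/
theorem mem_openSegment_or_mem_interior_convexHull {C : Set ℂ} (hC : ∀ z ∈ C, ‖z‖ = 1) {η : ℂ}
    (hη : η ∈ disk) (h : η ∈ convexHull ℝ C) :
    (∃ p ∈ C, ∃ q ∈ C, p ≠ q ∧ η ∈ openSegment ℝ p q) ∨ η ∈ interior (convexHull ℝ C) := by
  -- Carathéodory gives positive weights on at most three affinely independent points. One point
  -- would lie on the circle, two give a chord, and three give positive barycentric coordinates,
  -- hence an interior point of a triangle.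
  obtain ⟨ι, _, z, w, hz, hi, hw, hw1, hwz⟩ := eq_pos_convex_span_of_mem_convexHull h
  have hzC (i : ι) : z i ∈ C := hz ⟨i, rfl⟩
  have hcard : Fintype.card ι ≤ 3 := by
    have := hi.card_le_finrank_succ.trans (Nat.succ_le_succ (Submodule.finrank_le _))
    rwa [Complex.finrank_real_complex] at this
  obtain hc | hc : Fintype.card ι ≤ 2 ∨ Fintype.card ι = 3 := by omega
  · left
    obtain hc | hc | hc : Fintype.card ι = 0 ∨ Fintype.card ι = 1 ∨ Fintype.card ι = 2 := by omega
    · have := Fintype.card_eq_zero_iff.1 hc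
      simp at hw1
    · obtain ⟨i, hi⟩ := Fintype.card_eq_one_iff.1 hc
      have : Unique ι := ⟨⟨i⟩, hi⟩
      rw [Fintype.sum_unique] at hw1 hwz
      rw [hw1, one_smul] at hwz
      rw [mem_disk, ← hwz, hC _ (hzC _)] at hη
      exact absurd hη (lt_irrefl _)
    · let e := Fintype.equivFinOfCardEq hc
      rw [← e.symm.sum_comp, Fin.sum_univ_two] at hw1 hwz
      exact ⟨_, hzC (e.symm 0), _, hzC (e.symm 1), fun h => by simpa using hi.injective h,
        _, _, hw _, hw _, hw1, hwz⟩
  · right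
    let b : AffineBasis ι ℝ ℂ := ⟨z, hi, hi.affineSpan_eq_top_iff_card_eq_finrank_add_one.2
      (by rw [hc, Complex.finrank_real_complex])⟩
    refine interior_mono (convexHull_mono hz) ?_
    have hb : range z = range b := rfl
    rw [hb, b.interior_convexHull]
    intro i
    have hcomb : η = Finset.univ.affineCombination ℝ b w := by
      rw [Finset.affineCombination_eq_linear_combination _ _ _ hw1]
      exact hwz.symm
    rw [hcomb, b.coord_apply_combination_of_mem (Finset.mem_univ i) hw1]
    exact hw i

/-- If two chords with endpoints in `C` cross, the crossing point is interior to the hull of `C`. -/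
theorem eq_or_eq_of_mem_openSegment {C : Set ℂ} (hC : ∀ z ∈ C, ‖z‖ = 1) {η p q p' q' : ℂ}
    (hp : p ∈ C) (hq : q ∈ C) (hp' : p' ∈ C) (hq' : q' ∈ C) (hpq : p ≠ q) (hpq' : p' ≠ q')
    (h : η ∈ openSegment ℝ p q) (h' : η ∈ openSegment ℝ p' q')
    (hint : η ∉ interior (convexHull ℝ C)) : (p = p' ∧ q = q') ∨ (p = q' ∧ q = p') := by
  have hconv := convex_convexHull ℝ C
  have key : ∀ r ∈ C, r = p' ∨ r = q' → r = p ∨ r = q := by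
    by_contra! hne
    obtain ⟨r, hr, hr', hrp, hrq⟩ := hne
    have hne : (interior (convexHull ℝ {p, q, r})).Nonempty :=
      nonempty_interior_convexHull_triple (hC p hp) (hC q hq) (hC r hr) hpq hrp.symm hrq.symm
    have hsub : interior (convexHull ℝ {p, q, r}) ⊆ interior (convexHull ℝ C) := by
      refine interior_mono (convexHull_mono ?_)
      rintro _ (rfl | rfl | rfl) <;> assumption
    -- A supporting functional at η attains its maximum over the hull inside both chords, so it is
    -- constant on p, q, r. This contradicts the strict inequality at an interior point of that
    -- triangle.
    obtain ⟨f, hf⟩ := geometric_hahn_banach_open_point hconv.interior isOpen_interior hint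
    have hle : ∀ x ∈ C, f x ≤ f η := by
      intro x hx
      have hcl : x ∈ closure (interior (convexHull ℝ C)) := by
        rw [hconv.closure_interior_eq_closure_of_nonempty_interior (hne.mono hsub)]
        exact subset_closure (subset_convexHull ℝ C hx)
      exact closure_minimal (t := {x | f x ≤ f η}) (fun y hy => (hf y hy).le)
        (isClosed_le f.continuous continuous_const) hcl
    have hends : ∀ x ∈ C, ∀ y ∈ C, η ∈ openSegment ℝ x y → f x = f η ∧ f y = f η := by
      rintro x hx y hy ⟨a, b, ha, hb, hab, he⟩
      have e : a * f x + b * f y = f η := by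
        rw [← he, map_add, map_smul, map_smul, smul_eq_mul, smul_eq_mul]
      obtain rfl : b = 1 - a := by linarith
      constructor <;> nlinarith [hle x hx, hle y hy]
    have hr0 : f r = f η := by
      rcases hr' with rfl | rfl
      · exact (hends _ hp' _ hq' h').1
      · exact (hends _ hp' _ hq' h').2
    obtain ⟨y, hy⟩ := hne
    have hyf : f y = f η := by
      have hs : convexHull ℝ {p, q, r} ⊆ {x | f x = f η} := by
        refine convexHull_min ?_ (convex_hyperplane f.toLinearMap.isLinear _)
        rintro _ (rfl | rfl | rfl)
        · exact (hends _ hp _ hq h).1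
        · exact (hends _ hp _ hq h).2
        · exact hr0
      exact hs (interior_subset hy)
    exact (hf y (hsub hy)).ne hyf
  rcases key p' hp' (Or.inl rfl) with h1 | h1 <;> rcases key q' hq' (Or.inr rfl) with h2 | h2
  · exact absurd (h1.trans h2.symm) hpq'
  · exact Or.inl ⟨h1.symm, h2.symm⟩
  · exact Or.inr ⟨h2.symm, h1.symm⟩
  · exact absurd (h1.trans h2.symm) hpq'

/-! ### Chords -/

/-- The affine function vanishing on the line through `p` and `q`. -/
def chordFun (p q w : ℂ) : ℝ := area (q - p) (w - p)

theorem chordFun_combo (p q : ℂ) {x y : ℂ} {a b : ℝ} (h : a + b = 1) :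
    chordFun p q (a • x + b • y) = a * chordFun p q x + b * chordFun p q y := by
  obtain rfl : b = 1 - a := by linarith
  simp [chordFun, area]; ring

theorem continuous_chordFun (p q : ℂ) : Continuous (chordFun p q) := by
  have := Complex.continuous_re
  have := Complex.continuous_im
  unfold chordFun area
  fun_prop

theorem chordFun_eq_zero {p q w : ℂ} (h : w ∈ openSegment ℝ p q) : chordFun p q w = 0 := by
  obtain ⟨a, b, -, -, hab, rfl⟩ := h
  rw [chordFun_combo p q hab]
  simp only [chordFun, area, Complex.sub_re, Complex.sub_im]
  ring

theorem normSq_sub_pos {p q : ℂ} (h : p ≠ q) : 0 < (q.re - p.re) ^ 2 + (q.im - p.im) ^ 2 := by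
  by_contra! hc
  refine h (Complex.ext ?_ ?_) <;>
    nlinarith [sq_nonneg (q.re - p.re), sq_nonneg (q.im - p.im)]

theorem mem_openSegment_of_chordFun_eq_zero {p q : Circle} (hpq : p ≠ q) {w : ℂ} (hw : w ∈ disk)
    (h : chordFun p q w = 0) : w ∈ openSegment ℝ (p : ℂ) q := by
  have hp := circle_sq p
  have hq := circle_sq q
  rw [mem_disk_iff] at hw
  have hN := normSq_sub_pos (Circle.coe_injective.ne hpq)
  set P : ℂ := (p : ℂ)
  set Q : ℂ := (q : ℂ)
  set N := (Q.re - P.re) ^ 2 + (Q.im - P.im) ^ 2 with hNdef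
  set t := ((Q.re - P.re) * (w.re - P.re) + (Q.im - P.im) * (w.im - P.im)) / N with ht
  have htN : t * N = (Q.re - P.re) * (w.re - P.re) + (Q.im - P.im) * (w.im - P.im) :=
    div_mul_cancel₀ _ hN.ne'
  simp only [chordFun, area, Complex.sub_re, Complex.sub_im] at h
  have h1 : w.re = P.re + t * (Q.re - P.re) := by
    refine mul_right_cancel₀ hN.ne' ?_
    have : (P.re + t * (Q.re - P.re)) * N = P.re * N + (t * N) * (Q.re - P.re) := by ring
    rw [this, htN, hNdef]
    linear_combination -(Q.im - P.im) * h
  have h2 : w.im = P.im + t * (Q.im - P.im) := by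
    refine mul_right_cancel₀ hN.ne' ?_
    have : (P.im + t * (Q.im - P.im)) * N = P.im * N + (t * N) * (Q.im - P.im) := by ring
    rw [this, htN, hNdef]
    linear_combination (Q.re - P.re) * h
  -- For w = P + t(Q - P) with P, Q on the circle, |w|² = 1 + (t² - t)|Q - P|², so |w| < 1 forces 0
  -- < t < 1.
  have h3 : (t ^ 2 - t) * N < 0 := by
    have : w.re ^ 2 + w.im ^ 2 = 1 + (t ^ 2 - t) * N := by
      rw [h1, h2, hNdef]
      linear_combination (1 - t) * hp + t * hq
    linarith
  have h4 : t ^ 2 - t < 0 := by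
    by_contra! hc
    exact h3.not_ge (mul_nonneg hc hN.le)
  have h5 : 0 < t := by nlinarith
  have h6 : t < 1 := by nlinarith
  refine ⟨1 - t, t, by linarith, h5, by ring, Complex.ext ?_ ?_⟩
  · simp; linarith
  · simp; linarith

theorem exists_aff_eq_mul_chordFun {s : Side} {τ : Mink} {p q : ℂ} (hpq : p ≠ q)
    (hp : aff s τ p = 0) (hq : aff s τ q = 0) : ∃ c : ℝ, ∀ w, aff s τ w = c * chordFun p q w := by
  have hN := normSq_sub_pos hpq
  set N := (q.re - p.re) ^ 2 + (q.im - p.im) ^ 2 with hNdef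
  set A := s.sign * τ 1 with hA
  set B := s.sign * τ 2 with hB
  have hfun : ∀ w, aff s τ w = A * (w.re - p.re) + B * (w.im - p.im) := by
    intro w
    rw [← sub_zero (aff s τ w), ← hp]
    simp only [aff_eq, hA, hB]
    ring
  rw [hfun] at hq
  refine ⟨(B * (q.re - p.re) - A * (q.im - p.im)) / N, fun w => ?_⟩
  rw [hfun, div_mul_eq_mul_div, eq_div_iff hN.ne']
  simp only [chordFun, area, Complex.sub_re, Complex.sub_im, hNdef]
  linear_combination ((q.re - p.re) * (w.re - p.re) + (q.im - p.im) * (w.im - p.im)) * hq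

theorem eq_zero_of_aff_eq_zero {s : Side} {τ : Mink} (h : ∀ w, aff s τ w = 0) : τ = 0 :=
  eq_zero_of_aff_nonpos (h 0) (Eventually.of_forall fun w => (h w).le)

/-! ### Geodesics -/

/-- The geodesic with the given ideal endpoints. -/
def Geodesic.mk {p q : Circle} (h : p ≠ q) : Geodesic := Quotient.mk geodesicSetoid ⟨(p, q), h⟩

theorem Geodesic.exists_mk (l : Geodesic) : ∃ (p q : Circle) (h : p ≠ q), l = Geodesic.mk h := by
  induction l using Quotient.inductionOn with
  | h x => exact ⟨x.1.1, x.1.2, x.2, rfl⟩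

theorem openSegment_circle_subset_disk {p q : Circle} (h : p ≠ q) :
    openSegment ℝ (p : ℂ) q ⊆ disk :=
  openSegment_subset_ball_of_ne (mem_closedBall_zero_iff.2 p.norm_coe.le)
    (mem_closedBall_zero_iff.2 q.norm_coe.le) (Circle.coe_injective.ne h)

theorem Geodesic.carrier_subset_disk (l : Geodesic) : l.carrier ⊆ disk := by
  obtain ⟨p, q, h, rfl⟩ := l.exists_mk
  exact openSegment_circle_subset_disk h

theorem Geodesic.convex_carrier (l : Geodesic) : Convex ℝ l.carrier := by
  obtain ⟨p, q, h, rfl⟩ := l.exists_mk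
  exact convex_openSegment _ _

theorem Geodesic.carrier_nonempty (l : Geodesic) : l.carrier.Nonempty := by
  obtain ⟨p, q, h, rfl⟩ := l.exists_mk
  exact ⟨midpoint ℝ (p : ℂ) q, 1 / 2, 1 / 2, by norm_num, by norm_num, by norm_num, by
    rw [midpoint_eq_smul_add]; simp⟩

theorem Geodesic.eq_of_mem_of_mem {C : Set ℂ} (hC : ∀ z ∈ C, ‖z‖ = 1) {p q p' q' : Circle}
    {h : p ≠ q} {h' : p' ≠ q'} (hp : (p : ℂ) ∈ C) (hq : (q : ℂ) ∈ C) (hp' : (p' : ℂ) ∈ C)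
    (hq' : (q' : ℂ) ∈ C) {η : ℂ} (hη : η ∈ (Geodesic.mk h).carrier)
    (hη' : η ∈ (Geodesic.mk h').carrier) (hint : η ∉ interior (convexHull ℝ C)) :
    Geodesic.mk h = Geodesic.mk h' := by
  refine Quotient.sound ?_
  rcases eq_or_eq_of_mem_openSegment hC hp hq hp' hq' (Circle.coe_injective.ne h)
    (Circle.coe_injective.ne h') hη hη' hint with ⟨h1, h2⟩ | ⟨h1, h2⟩
  · exact Or.inl (Prod.ext (Circle.coe_injective h1) (Circle.coe_injective h2))
  · exact Or.inr (Prod.ext (Circle.coe_injective h1) (Circle.coe_injective h2))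

end InfEarthquake

namespace InfEarthquake

/-! ### Affine functions below a function on the circle -/

/-- The affine function of `σ` is at most `φ` on the circle. -/
def Below (s : Side) (φ : Circle → ℝ) (σ : Mink) : Prop := ∀ z : Circle, aff s σ z ≤ φ z

/-- The points of the circle where the affine function of `σ` agrees with `φ`. -/
def contact (s : Side) (φ : Circle → ℝ) (σ : Mink) : Set ℂ :=
  (fun z : Circle => (z : ℂ)) '' {z | aff s σ z = φ z}

/-- The affine function of `σ` supports the lower convex envelope of `φ` at `η`. -/
def Supp (s : Side) (φ : Circle → ℝ) (σ : Mink) (η : ℂ) : Prop :=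
  Below s φ σ ∧ η ∈ convexHull ℝ (contact s φ σ)

/-- The lower convex envelope of `φ`. -/
noncomputable def env (s : Side) (φ : Circle → ℝ) (η : ℂ) : ℝ :=
  sSup ((fun σ => aff s σ η) '' {σ | Below s φ σ})

variable {s : Side} {φ : Circle → ℝ}

theorem norm_of_mem_contact {σ : Mink} {z : ℂ} (hz : z ∈ contact s φ σ) : ‖z‖ = 1 := by
  obtain ⟨z, -, rfl⟩ := hz
  exact z.norm_coe

theorem coe_mem_contact {σ : Mink} {z : Circle} : (z : ℂ) ∈ contact s φ σ ↔ aff s σ z = φ z :=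
  ⟨fun ⟨_, h, e⟩ => by rwa [← Circle.coe_injective e], fun h => ⟨z, h, rfl⟩⟩

theorem exists_aff (s : Side) (a b c : ℝ) :
    ∃ τ : Mink, ∀ w : ℂ, aff s τ w = a + b * w.re + c * w.im := by
  refine ⟨![-(s.sign * a), s.sign * b, s.sign * c], fun w => ?_⟩
  have := s.sign_mul_self
  simp [aff_eq]
  linear_combination (a + b * w.re + c * w.im) * this

theorem convex_aff_le (s : Side) (σ τ : Mink) : Convex ℝ {w | aff s σ w ≤ aff s τ w} := by
  intro x hx y hy a b ha hb hab
  simp only [mem_ofPred_eq] at *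
  rw [aff_combo s σ hab, aff_combo s τ hab]
  gcongr

theorem aff_le_of_norm_le_one {σ τ : Mink} (h : ∀ z : Circle, aff s σ z ≤ aff s τ z) {w : ℂ}
    (hw : ‖w‖ ≤ 1) : aff s σ w ≤ aff s τ w := by
  have hs : convexHull ℝ (Metric.sphere (0 : ℂ) 1) ⊆ {w | aff s σ w ≤ aff s τ w} :=
    convexHull_min (fun z hz => h ⟨z, by simpa [Submonoid.unitSphere] using hz⟩)
      (convex_aff_le s σ τ)
  rw [convexHull_sphere_eq_closedBall 0 zero_le_one] at hs
  exact hs (by simpa using hw)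

theorem Supp.aff_le {σ τ : Mink} {η : ℂ} (h : Supp s φ σ η) (hτ : Below s φ τ) :
    aff s τ η ≤ aff s σ η := by
  refine convexHull_min ?_ (convex_aff_le s τ σ) h.2
  rintro _ ⟨z, hz, rfl⟩
  exact (hτ z).trans_eq (Eq.symm hz)

theorem Supp.env_eq {σ : Mink} {η : ℂ} (h : Supp s φ σ η) : env s φ η = aff s σ η :=
  IsGreatest.csSup_eq ⟨⟨σ, h.1, rfl⟩, by rintro _ ⟨τ, hτ, rfl⟩; exact h.aff_le hτ⟩

theorem aff_sum {ι : Type*} [Fintype ι] (σ : Mink) {w : ι → ℝ} (hw : ∑ i, w i = 1) (z : ι → ℂ) :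
    aff s σ (∑ i, w i • z i) = ∑ i, w i * aff s σ (z i) := by
  have h (x : ℂ) : aff s σ x = aff s σ 0 + inner ℝ (grad s σ) x := by
    simpa using aff_eq_add s σ 0 x
  have h' (i : ι) : w i * aff s σ (z i) = w i * aff s σ 0 + w i * inner ℝ (grad s σ) (z i) := by
    rw [h, mul_add]
  rw [h, inner_sum, Finset.sum_congr rfl fun i _ => h' i, Finset.sum_add_distrib, ← Finset.sum_mul,
    hw, one_mul]
  simp only [inner_smul_right]

/-- η is a combination of contact points of σ with positive weights. Equality of the sums forces
equality in each term, so τ touches φ at the same points. -/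
theorem Supp.of_aff_le {σ τ : Mink} {η : ℂ} (h : Supp s φ σ η) (hτ : Below s φ τ)
    (he : aff s σ η ≤ aff s τ η) : Supp s φ τ η := by
  refine ⟨hτ, ?_⟩
  obtain ⟨ι, _, z, w, hz, -, hw, hw1, hwz⟩ := eq_pos_convex_span_of_mem_convexHull h.2
  choose ζ hζ hζz using fun i => hz ⟨i, rfl⟩
  have haff (ρ : Mink) : aff s ρ η = ∑ i, w i * aff s ρ (z i) := by
    rw [← hwz, aff_sum ρ hw1]
  have hle (i) : aff s τ (z i) ≤ aff s σ (z i) := by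
    rw [← hζz i]
    exact (hτ (ζ i)).trans_eq (Eq.symm (hζ i))
  have heq : ∀ i ∈ Finset.univ, w i * aff s τ (z i) = w i * aff s σ (z i) :=
    (Finset.sum_eq_sum_iff_of_le fun i _ => mul_le_mul_of_nonneg_left (hle i) (hw i).le).1
      (by rw [← haff, ← haff]; exact (h.aff_le hτ).antisymm he)
  rw [← hwz]
  refine (convex_convexHull ℝ _).sum_mem (fun i _ => (hw i).le) hw1 fun i _ =>
    subset_convexHull ℝ _ ⟨ζ i, ?_, hζz i⟩
  have := mul_left_cancel₀ (hw i).ne' (heq i (Finset.mem_univ i))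
  rw [mem_ofPred_eq, ← (hζ i : aff s σ (ζ i) = φ (ζ i))]
  have e := hζz i
  simp only at e
  rw [e, this]

/-- Support planes at a point of a chord of contact are in contact at the ends of the chord. -/
theorem contact_of_mem_openSegment {σ τ : Mink} {p q : Circle} {η : ℂ}
    (hη : η ∈ openSegment ℝ (p : ℂ) q) (hp : aff s σ p = φ p) (hq : aff s σ q = φ q)
    (hτ : Below s φ τ) (he : aff s σ η ≤ aff s τ η) : aff s τ p = φ p ∧ aff s τ q = φ q := by
  obtain ⟨a, b, ha, hb, hab, rfl⟩ := hη
  rw [aff_combo s σ hab, aff_combo s τ hab, hp, hq] at he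
  constructor
  · refine (hτ p).antisymm (le_of_mul_le_mul_left ?_ ha)
    linarith [mul_le_mul_of_nonneg_left (hτ q) hb.le]
  · refine (hτ q).antisymm (le_of_mul_le_mul_left ?_ hb)
    linarith [mul_le_mul_of_nonneg_left (hτ p) ha.le]

theorem supp_of_mem_openSegment {σ : Mink} {p q : Circle} {η : ℂ} (hσ : Below s φ σ)
    (hp : aff s σ p = φ p) (hq : aff s σ q = φ q) (hη : η ∈ openSegment ℝ (p : ℂ) q) :
    Supp s φ σ η :=
  ⟨hσ, (convex_convexHull ℝ _).openSegment_subset (subset_convexHull ℝ _ (coe_mem_contact.2 hp))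
    (subset_convexHull ℝ _ (coe_mem_contact.2 hq)) hη⟩

/-! ### Compactness -/

/-- The point w is reached from η by moving 1 - |η| up the gradient. As w stays in the closed disk,
an upper bound for the function there bounds the gradient. -/
theorem exists_norm_le_one_aff_eq (σ : Mink) {η : ℂ} (hη : η ∈ disk) :
    ∃ w : ℂ, ‖w‖ ≤ 1 ∧ ‖w - η‖ ≤ 1 - ‖η‖ ∧
      aff s σ w = aff s σ η + (1 - ‖η‖) * ‖grad s σ‖ := by
  have h1 : 0 ≤ 1 - ‖η‖ := by linarith [mem_disk.1 hη]
  rcases eq_or_ne (grad s σ) 0 with h0 | h0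
  · exact ⟨η, (mem_disk.1 hη).le, by simpa using h1, by simp [h0]⟩
  have hg : 0 < ‖grad s σ‖ := norm_pos_iff.2 h0
  set v : ℂ := ((1 - ‖η‖) / ‖grad s σ‖) • grad s σ with hv
  have hvn : ‖v‖ = 1 - ‖η‖ := by
    rw [hv, norm_smul, Real.norm_of_nonneg (div_nonneg h1 hg.le), div_mul_cancel₀ _ hg.ne']
  refine ⟨η + v, ?_, by rw [add_sub_cancel_left, hvn], ?_⟩
  · linarith [norm_add_le η v]
  · rw [aff_eq_add s σ η, add_sub_cancel_left, hv, inner_smul_right, real_inner_self_eq_norm_sq]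
    field_simp

theorem norm_le_of_mem_disk (σ : Mink) {η : ℂ} (hη : η ∈ disk) :
    ‖σ‖ ≤ |aff s σ η| + ‖grad s σ‖ := by
  have hsgn : |s.sign| = 1 := by cases s <;> simp [Side.sign]
  have hnn : 0 ≤ |aff s σ η| := abs_nonneg _
  rw [pi_norm_le_iff_of_nonneg (by positivity)]
  intro i
  fin_cases i
  · have e := aff_eq_add s σ η 0
    have e' : |aff s σ 0| = |σ 0| := by rw [aff_eq]; simp [abs_mul, hsgn]
    have h1 := abs_real_inner_le_norm (grad s σ) (0 - η)
    have h2 := abs_add_le (aff s σ η) (inner ℝ (grad s σ) (0 - η))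
    rw [← e, e'] at h2
    have h3 : ‖grad s σ‖ * ‖0 - η‖ ≤ ‖grad s σ‖ * 1 :=
      mul_le_mul_of_nonneg_left (by simpa using (mem_disk.1 hη).le) (norm_nonneg _)
    simp only [Fin.zero_eta, Real.norm_eq_abs]
    linarith
  · have := Complex.abs_re_le_norm (grad s σ)
    simp only [grad, abs_mul, hsgn, one_mul] at this
    simp only [Fin.mk_one, Real.norm_eq_abs]
    exact this.trans (le_add_of_nonneg_left hnn)
  · have := Complex.abs_im_le_norm (grad s σ)
    simp only [grad, abs_mul, hsgn, one_mul] at this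
    simp only [Fin.reduceFinMk, Real.norm_eq_abs]
    exact this.trans (le_add_of_nonneg_left hnn)

theorem exists_above (hφ : Continuous φ) : ∃ M : ℝ, ∀ z, |φ z| ≤ M := by
  obtain ⟨M, hM⟩ := isCompact_univ.exists_bound_of_continuousOn hφ.continuousOn
  exact ⟨M, fun z => hM z trivial⟩

theorem Below.norm_grad_le {σ : Mink} (hσ : Below s φ σ) {M : ℝ} (hM : ∀ z, |φ z| ≤ M) {η : ℂ}
    (hη : η ∈ disk) : (1 - ‖η‖) * ‖grad s σ‖ ≤ M - aff s σ η := by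
  obtain ⟨τ, hτ⟩ := exists_aff s M 0 0
  obtain ⟨w, hw, -, he⟩ := exists_norm_le_one_aff_eq (s := s) σ hη
  have := aff_le_of_norm_le_one (s := s) (σ := σ) (τ := τ)
    (fun z => (hσ z).trans (by rw [hτ]; simpa using (le_abs_self _).trans (hM z))) hw
  rw [he, hτ] at this
  linarith

theorem Below.norm_le {σ : Mink} (hσ : Below s φ σ) {M : ℝ} (hM : ∀ z, |φ z| ≤ M) {η : ℂ}
    (hη : η ∈ disk) : ‖σ‖ ≤ |aff s σ η| + (M - aff s σ η) / (1 - ‖η‖) := by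
  refine (norm_le_of_mem_disk (s := s) σ hη).trans ?_
  gcongr
  rw [le_div_iff₀ (by linarith [mem_disk.1 hη]), mul_comm]
  exact hσ.norm_grad_le hM hη

theorem isClosed_below : IsClosed {σ | Below s φ σ} := by
  simp only [Below, ofPred_forall]
  exact isClosed_iInter fun z => isClosed_le (continuous_aff_left s _) continuous_const

/-- For functions below φ the gradient is controlled by the value at an interior point, so a lower
bound on that value bounds σ. -/
theorem isCompact_below (hφ : Continuous φ) {η : ℂ} (hη : η ∈ disk) (c : ℝ) :
    IsCompact {σ | Below s φ σ ∧ c ≤ aff s σ η} := by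
  obtain ⟨M, hM⟩ := exists_above hφ
  refine Metric.isCompact_of_isClosed_isBounded
    (isClosed_below.inter (isClosed_le continuous_const (continuous_aff_left s η))) ?_
  refine (Metric.isBounded_closedBall (x := (0 : Mink))
    (r := |c| + |M| + (M - c) / (1 - ‖η‖))).subset fun σ hσ => ?_
  have h0 : 0 < 1 - ‖η‖ := by linarith [mem_disk.1 hη]
  have h1 := hσ.1.norm_le hM hη
  have hg := hσ.1.norm_grad_le hM hη
  have h2 : aff s σ η ≤ M := by
    have : 0 ≤ (1 - ‖η‖) * ‖grad s σ‖ := by positivity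
    linarith
  have h3 : |aff s σ η| ≤ |c| + |M| := by
    rw [abs_le]
    constructor
    · linarith [neg_abs_le c, abs_nonneg M, hσ.2]
    · linarith [le_abs_self M, abs_nonneg c]
  have h4 : (M - aff s σ η) / (1 - ‖η‖) ≤ (M - c) / (1 - ‖η‖) := by
    gcongr
    exact hσ.2
  rw [mem_closedBall_zero_iff]
  linarith

/-! ### Existence of support planes -/

theorem mem_convexHull_contact {σ : Mink} (hσ : Below s φ σ) {η : ℂ} {t : ℝ}
    (h : (η, t) ∈ convexHull ℝ (range fun z : Circle => ((z : ℂ), φ z)))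
    (ht : t ≤ aff s σ η) : η ∈ convexHull ℝ (contact s φ σ) := by
  obtain ⟨ι, _, z, w, hz, -, hw, hw1, hwz⟩ := eq_pos_convex_span_of_mem_convexHull h
  choose ζ hζ using fun i => hz ⟨i, rfl⟩
  have hη : ∑ i, w i • (ζ i : ℂ) = η := by
    have := congrArg Prod.fst hwz
    simp only [← hζ, Prod.fst_sum, Prod.smul_fst] at this
    exact this
  have ht' : ∑ i, w i * φ (ζ i) = t := by
    have := congrArg Prod.snd hwz
    simp only [← hζ, Prod.snd_sum, Prod.smul_snd, smul_eq_mul] at this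
    exact this
  have haff (ρ : Mink) : aff s ρ η = ∑ i, w i * aff s ρ (ζ i) := by
    rw [← hη, aff_sum ρ hw1]
  have hle : ∀ i ∈ Finset.univ, w i * aff s σ (ζ i) ≤ w i * φ (ζ i) := fun i _ =>
    mul_le_mul_of_nonneg_left (hσ _) (hw i).le
  have heq := (Finset.sum_eq_sum_iff_of_le hle).1
    ((Finset.sum_le_sum hle).antisymm (by rw [ht', ← haff]; exact ht))
  rw [← hη]
  exact (convex_convexHull ℝ _).sum_mem (fun i _ => (hw i).le) hw1 fun i _ =>
    subset_convexHull ℝ _ (coe_mem_contact.2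
      (mul_left_cancel₀ (hw i).ne' (heq i (Finset.mem_univ i))))

theorem le_of_mem_convexHull_graph {σ : Mink} (hσ : Below s φ σ) {p : ℂ × ℝ}
    (h : p ∈ convexHull ℝ (range fun z : Circle => ((z : ℂ), φ z))) : aff s σ p.1 ≤ p.2 := by
  refine convexHull_min (t := {p : ℂ × ℝ | aff s σ p.1 ≤ p.2}) ?_ ?_ h
  · rintro _ ⟨z, rfl⟩
    exact hσ z
  · intro x hx y hy a b ha hb hab
    simp only [mem_ofPred_eq, Prod.fst_add, Prod.smul_fst, Prod.snd_add, Prod.smul_snd,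
      smul_eq_mul] at *
    rw [aff_combo s σ hab]
    gcongr

theorem exists_mem_convexHull_graph (φ : Circle → ℝ) {η : ℂ} (hη : η ∈ disk) :
    ∃ t, (η, t) ∈ convexHull ℝ (range fun z : Circle => ((z : ℂ), φ z)) := by
  have h1 : η ∈ convexHull ℝ (Metric.sphere (0 : ℂ) 1) := by
    rw [convexHull_sphere_eq_closedBall 0 zero_le_one]
    exact Metric.ball_subset_closedBall hη
  have h2 : Metric.sphere (0 : ℂ) 1 ⊆
      LinearMap.fst ℝ ℂ ℝ '' range fun z : Circle => ((z : ℂ), φ z) := fun z hz =>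
    ⟨_, ⟨⟨z, by simpa [Submonoid.unitSphere] using hz⟩, rfl⟩, rfl⟩
  have h3 := convexHull_mono h2 h1
  rw [← LinearMap.image_convexHull] at h3
  obtain ⟨⟨_, t⟩, ht, rfl⟩ := h3
  exact ⟨t, ht⟩

/-- A function below φ with maximal value at η works: if its graph missed the hull over η, a
hyperplane strictly separating that point from the hull would be the graph of a larger competitor.
-/
theorem exists_supp (hφ : Continuous φ) {η : ℂ} (hη : η ∈ disk) : ∃ σ, Supp s φ σ η := by
  obtain ⟨M, hM⟩ := exists_above hφ
  obtain ⟨τ, hτ⟩ := exists_aff s (-M) 0 0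
  have hτB : Below s φ τ := fun z => by
    rw [hτ]; simpa using (neg_le_neg (hM z)).trans (neg_abs_le _)
  obtain ⟨σ, ⟨hσB, hσc⟩, hmax⟩ := (isCompact_below (s := s) hφ hη (aff s τ η)).exists_isMaxOn
    ⟨τ, hτB, le_rfl⟩ (continuous_aff_left s η).continuousOn
  refine ⟨σ, hσB, ?_⟩
  refine mem_convexHull_contact hσB (t := aff s σ η) ?_ le_rfl
  by_contra hnot
  have hcpt : IsCompact (convexHull ℝ (range fun z : Circle => ((z : ℂ), φ z))) :=
    isCompact_convexHull_of_isCompact (isCompact_range (by fun_prop))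
  obtain ⟨f, u, hfu, hub⟩ := geometric_hahn_banach_point_closed (convex_convexHull ℝ _)
    hcpt.isClosed hnot
  have hf (w : ℂ) (t : ℝ) : f (w, t) = w.re * f (1, 0) + w.im * f (Complex.I, 0) + t * f (0, 1) := by
    have : (w, t) = w.re • ((1, 0) : ℂ × ℝ) + w.im • ((Complex.I, 0) : ℂ × ℝ)
        + t • ((0, 1) : ℂ × ℝ) := by
      ext <;> simp
    rw [this]
    simp only [map_add, map_smul, smul_eq_mul]
  set c := f (0, 1)
  obtain ⟨t, ht⟩ := exists_mem_convexHull_graph φ hη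
  have h1 := hub _ ht
  have h2 := le_of_mem_convexHull_graph hσB ht
  -- The hull contains a point above (η, aff s σ η), so the separating hyperplane is not vertical
  -- and ρ below can be solved for from f = u.
  have hc : 0 < c := by
    rw [hf] at h1 hfu
    have : 0 < (t - aff s σ η) * c := by linarith
    exact pos_of_mul_pos_right this (sub_nonneg.2 h2)
  obtain ⟨ρ, hρ⟩ := exists_aff s (u / c) (-f (1, 0) / c) (-f (Complex.I, 0) / c)
  have hρc (w : ℂ) : aff s ρ w * c = u - w.re * f (1, 0) - w.im * f (Complex.I, 0) := by
    rw [hρ]; field_simp; ring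
  have hρB : Below s φ ρ := by
    intro z
    have := hub _ (subset_convexHull ℝ _ ⟨z, rfl⟩)
    rw [hf] at this
    refine le_of_mul_le_mul_right ?_ hc
    rw [hρc]; linarith
  have hlt : aff s σ η < aff s ρ η := by
    refine lt_of_mul_lt_mul_right ?_ hc.le
    rw [hρc]
    rw [hf] at hfu
    linarith
  exact hlt.not_ge (hmax ⟨hρB, hσc.trans hlt.le⟩)

theorem Below.aff_le_env (hφ : Continuous φ) {σ : Mink} (hσ : Below s φ σ) {η : ℂ}
    (hη : η ∈ disk) : aff s σ η ≤ env s φ η := by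
  obtain ⟨τ, hτ⟩ := exists_supp (s := s) hφ hη
  rw [hτ.env_eq]
  exact hτ.aff_le hσ

theorem supp_iff (hφ : Continuous φ) {σ : Mink} {η : ℂ} (hη : η ∈ disk) :
    Supp s φ σ η ↔ Below s φ σ ∧ aff s σ η = env s φ η := by
  refine ⟨fun h => ⟨h.1, h.env_eq.symm⟩, fun ⟨h1, h2⟩ => ?_⟩
  obtain ⟨τ, hτ⟩ := exists_supp (s := s) hφ hη
  exact hτ.of_aff_le h1 (by rw [h2, hτ.env_eq])

theorem isCompact_supp (hφ : Continuous φ) {η : ℂ} (hη : η ∈ disk) :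
    IsCompact {σ | Supp s φ σ η} := by
  have : {σ | Supp s φ σ η} = {σ | Below s φ σ ∧ env s φ η ≤ aff s σ η} := by
    ext σ
    rw [mem_ofPred_eq, supp_iff hφ hη]
    exact ⟨fun h => ⟨h.1, h.2.ge⟩, fun h => ⟨h.1, (h.1.aff_le_env hφ hη).antisymm h.2⟩⟩
  rw [this]
  exact isCompact_below hφ hη _

theorem convexOn_of_support {v : ℂ → ℝ} {m : ℂ → Mink} (hv : ∀ η ∈ disk, v η = aff s (m η) η)
    (hle : ∀ η ∈ disk, ∀ ζ ∈ disk, aff s (m η) ζ ≤ v ζ) : ConvexOn ℝ disk v := by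
  refine ⟨convex_disk, fun x hx y hy a b ha hb hab => ?_⟩
  have hm := convex_disk hx hy ha hb hab
  rw [hv _ hm, aff_combo s _ hab, smul_eq_mul, smul_eq_mul]
  exact add_le_add (mul_le_mul_of_nonneg_left (hle _ hm _ hx) ha)
    (mul_le_mul_of_nonneg_left (hle _ hm _ hy) hb)

theorem continuousOn_env (hφ : Continuous φ) : ContinuousOn (env s φ) disk := by
  choose! m hm using fun η (hη : η ∈ disk) => exists_supp (s := s) hφ hη
  exact (convexOn_of_support (m := m) (fun η hη => (hm η hη).env_eq)
    fun η hη ζ hζ => (hm η hη).1.aff_le_env hφ hζ).continuousOn isOpen_disk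

/-! ### Boundary behaviour -/

/-- On the circle |z - z₀|² is affine in z, so a constant plus a multiple of it is an affine
majorant of φ that is nearly sharp at z₀. The factor K is chosen so that the quadratic term reaches
|M - A| at distance δ. -/
theorem exists_upper_barrier (s : Side) (hφ : Continuous φ) (z₀ : Circle) {ε : ℝ} (hε : 0 < ε) :
    ∃ τ, (∀ z : Circle, φ z ≤ aff s τ z) ∧ aff s τ z₀ < φ z₀ + ε := by
  obtain ⟨M, hM⟩ := exists_above hφ
  obtain ⟨δ, hδ, hclose⟩ := Metric.continuous_iff.1 hφ z₀ (ε / 2) (half_pos hε)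
  set A := φ z₀ + ε / 2 with hA
  set K := |M - A| * 2 / δ ^ 2 with hK
  have hK0 : 0 ≤ K := by positivity
  obtain ⟨τ, hτ⟩ := exists_aff s (A + K) (-(K * (z₀ : ℂ).re)) (-(K * (z₀ : ℂ).im))
  have hz₀ := circle_sq z₀
  have hval (z : Circle) : aff s τ z = A + K * (dist z z₀ ^ 2 / 2) := by
    have hz := circle_sq z
    have hd : dist z z₀ ^ 2 =
        ((z : ℂ).re - (z₀ : ℂ).re) ^ 2 + ((z : ℂ).im - (z₀ : ℂ).im) ^ 2 := by
      change dist (z : ℂ) z₀ ^ 2 = _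
      rw [dist_eq_norm, Complex.sq_norm, Complex.normSq_apply]
      simp [sq]
    rw [hτ, hd]
    linear_combination -(K / 2) * hz - (K / 2) * hz₀
  refine ⟨τ, fun z => ?_, ?_⟩
  · rw [hval]
    rcases lt_or_ge (dist z z₀) δ with h | h
    · have h1 := (abs_lt.1 (Real.dist_eq _ _ ▸ hclose z h)).2
      have : 0 ≤ K * (dist z z₀ ^ 2 / 2) := by positivity
      linarith
    · have h1 : K * (δ ^ 2 / 2) ≤ K * (dist z z₀ ^ 2 / 2) := by gcongr
      have h2 : K * (δ ^ 2 / 2) = |M - A| := by rw [hK]; field_simp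
      linarith [le_abs_self (M - A), le_abs_self (φ z), hM z]
  · rw [hval, dist_self]
    simp only [hA]; linarith

theorem exists_lower_barrier (s : Side) (hφ : Continuous φ) (z₀ : Circle) {ε : ℝ} (hε : 0 < ε) :
    ∃ τ, Below s φ τ ∧ φ z₀ - ε < aff s τ z₀ := by
  obtain ⟨τ, h1, h2⟩ := exists_upper_barrier s hφ.neg z₀ hε
  have hneg (w : ℂ) : aff s (-τ) w = -aff s τ w := by simp [aff_eq]; ring
  simp only [Pi.neg_apply] at h1 h2
  exact ⟨-τ, fun z => by rw [hneg]; linarith [h1 z], by rw [hneg]; linarith⟩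

theorem one_sub_norm_le (z : Circle) (η : ℂ) : 1 - ‖η‖ ≤ ‖η - z‖ := by
  have := norm_sub_norm_le (z : ℂ) η
  rwa [z.norm_coe, norm_sub_rev] at this

/-- The lower barrier bounds the value from below. The upper barrier, applied at η and at the point
1 - |η| up the gradient, bounds both the value and the increase (1 - |η|)|∇|. -/
theorem eventually_supp (hφ : Continuous φ) (z : Circle) {ε : ℝ} (hε : 0 < ε) :
    ∀ᶠ η in 𝓝[disk] (z : ℂ), ∀ σ, Supp s φ σ η →
      |aff s σ η - φ z| < ε ∧ (1 - ‖η‖) * ‖grad s σ‖ < ε := by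
  obtain ⟨τ, hτ, hτz⟩ := exists_upper_barrier s hφ z (by positivity : 0 < ε / 4)
  obtain ⟨ρ, hρ, hρz⟩ := exists_lower_barrier s hφ z (by positivity : 0 < ε / 4)
  obtain ⟨δ, hδ, hτδ⟩ := Metric.continuous_iff.1 (continuous_aff_right s τ) z (ε / 4) (by positivity)
  obtain ⟨δ', hδ', hρδ⟩ :=
    Metric.continuous_iff.1 (continuous_aff_right s ρ) z (ε / 4) (by positivity)
  -- The uphill point w is at most twice as far from z as η, whence δ / 2.
  have hball : Metric.ball (z : ℂ) (min (δ / 2) δ') ∈ 𝓝 (z : ℂ) :=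
    Metric.ball_mem_nhds _ (by positivity)
  filter_upwards [mem_nhdsWithin_of_mem_nhds hball, self_mem_nhdsWithin] with η hη hηd σ hσ
  rw [mem_ball_iff_norm] at hη
  have hη1 : ‖η - z‖ < δ / 2 := hη.trans_le (min_le_left _ _)
  have hη2 : ‖η - z‖ < δ' := hη.trans_le (min_le_right _ _)
  obtain ⟨w, hw1, hwη, hw⟩ := exists_norm_le_one_aff_eq (s := s) σ hηd
  have hup : ∀ x : ℂ, ‖x‖ ≤ 1 → aff s σ x ≤ aff s τ x := fun x hx =>
    aff_le_of_norm_le_one (fun z => (hσ.1 z).trans (hτ z)) hx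
  have hwz : ‖w - z‖ < δ := by
    have h1 := norm_add_le (w - η) (η - z)
    rw [sub_add_sub_cancel] at h1
    linarith [one_sub_norm_le z η]
  have h1 := hup w hw1
  have h2 := hup η (mem_disk.1 hηd).le
  have h3 := hσ.aff_le hρ
  have h4 := (abs_lt.1 (Real.dist_eq _ _ ▸ hτδ w (by rwa [dist_eq_norm]))).2
  have h5 := (abs_lt.1 (Real.dist_eq _ _ ▸ hτδ η (by rw [dist_eq_norm]; linarith))).2
  have h6 := (abs_lt.1 (Real.dist_eq _ _ ▸ hρδ η (by rwa [dist_eq_norm]))).1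
  refine ⟨abs_lt.2 ⟨by linarith, by linarith⟩, by linarith⟩

theorem tendsto_env (hφ : Continuous φ) (z : Circle) :
    Tendsto (env s φ) (𝓝[disk] (z : ℂ)) (𝓝 (φ z)) := by
  rw [Metric.tendsto_nhds]
  intro ε hε
  filter_upwards [eventually_supp (s := s) hφ z hε, self_mem_nhdsWithin] with η h hη
  obtain ⟨σ, hσ⟩ := exists_supp (s := s) hφ hη
  rw [hσ.env_eq, Real.dist_eq]
  exact (h σ hσ).1

end InfEarthquake

namespace InfEarthquake

/-! ### Laminations -/

theorem mem_locus {L : Set Geodesic} {η : ℂ} : η ∈ locus L ↔ ∃ l ∈ L, η ∈ l.carrier := by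
  simp [locus]

theorem isClosed_setOf_mk_mem {L : Set Geodesic} :
    IsClosed {x : {p : Circle × Circle // p.1 ≠ p.2} | Geodesic.mk x.2 ∈ L} ↔ IsClosed L :=
  (isQuotientMap_quotient_mk' (s := geodesicSetoid)).isClosed_preimage

/-- The locus of a closed set of geodesics is relatively closed in the disk. -/
theorem exists_isCompact_locus {L : Set Geodesic} (hL : IsClosed L) :
    ∃ K, IsCompact K ∧ locus L = disk ∩ K := by
  obtain ⟨F, hF, hFL⟩ := isClosed_induced_iff.1 (isClosed_setOf_mk_mem.2 hL)
  have hmem (p q : Circle) (h : p ≠ q) : (p, q) ∈ F ↔ Geodesic.mk h ∈ L :=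
    Set.ext_iff.1 hFL ⟨(p, q), h⟩
  let f : (Circle × Circle) × ℝ → ℂ := fun x => (1 - x.2) • (x.1.1 : ℂ) + x.2 • (x.1.2 : ℂ)
  have hf : Continuous f := by fun_prop
  refine ⟨f '' (F ×ˢ Icc 0 1), (hF.isCompact.prod isCompact_Icc).image hf, ?_⟩
  ext η
  rw [mem_locus]
  constructor
  · rintro ⟨l, hl, hη⟩
    refine ⟨l.carrier_subset_disk hη, ?_⟩
    obtain ⟨p, q, h, rfl⟩ := l.exists_mk
    obtain ⟨a, b, ha, hb, hab, rfl⟩ := hη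
    exact ⟨((p, q), b), ⟨(hmem p q h).2 hl, hb.le, by linarith⟩, by simp [f, ← hab]⟩
  · rintro ⟨hη, ⟨⟨p, q⟩, t⟩, ⟨hpq, ht0, ht1⟩, rfl⟩
    -- F may contain diagonal pairs. These, like the parameters 0 and 1, give points of the circle
    -- only.
    have hpq' : p ≠ q := by
      rintro rfl
      refine circle_notMem_disk p ?_
      convert hη using 1
      simp only [f]; module
    have h0 : t ≠ 0 := by
      rintro rfl
      exact circle_notMem_disk p (by simpa [f] using hη)
    have h1 : t ≠ 1 := by
      rintro rfl
      exact circle_notMem_disk q (by simpa [f] using hη)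
    exact ⟨_, (hmem p q hpq').1 hpq, 1 - t, t, sub_pos.2 (ht1.lt_of_ne h1), ht0.lt_of_ne' h0,
      by ring, rfl⟩

theorem isOpen_disk_diff_locus {L : Set Geodesic} (hL : IsClosed L) :
    IsOpen (disk \ locus L) := by
  obtain ⟨K, hK, h⟩ := exists_isCompact_locus hL
  rw [h, sdiff_self_inter]
  exact isOpen_disk.sdiff hK.isClosed

theorem IsGap.subset {L : Set Geodesic} {G : Set ℂ} (hG : IsGap L G) : G ⊆ disk \ locus L := by
  obtain ⟨η, -, rfl⟩ := hG
  exact connectedComponentIn_subset _ _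

theorem IsGap.isOpen {L : Set Geodesic} (hL : IsClosed L) {G : Set ℂ} (hG : IsGap L G) :
    IsOpen G := by
  obtain ⟨η, -, rfl⟩ := hG
  exact (isOpen_disk_diff_locus hL).connectedComponentIn

theorem IsStratum.subset_disk {L : Set Geodesic} {S : Set ℂ} (hS : IsStratum L S) : S ⊆ disk := by
  obtain ⟨l, -, rfl⟩ | hG := hS
  · exact l.carrier_subset_disk
  · exact hG.subset.trans sdiff_subset

theorem IsStratum.nonempty {L : Set Geodesic} {S : Set ℂ} (hS : IsStratum L S) : S.Nonempty := by
  obtain ⟨l, -, rfl⟩ | ⟨η, hη, rfl⟩ := hS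
  · exact l.carrier_nonempty
  · exact ⟨η, mem_connectedComponentIn hη⟩

theorem IsStratum.isPreconnected {L : Set Geodesic} {S : Set ℂ} (hS : IsStratum L S) :
    IsPreconnected S := by
  obtain ⟨l, -, rfl⟩ | ⟨η, hη, rfl⟩ := hS
  · exact l.convex_carrier.isPreconnected
  · exact isPreconnected_connectedComponentIn

theorem exists_isStratum (L : Set Geodesic) {η : ℂ} (hη : η ∈ disk) :
    ∃ S, IsStratum L S ∧ η ∈ S := by
  by_cases h : η ∈ locus L
  · obtain ⟨l, hl, hη⟩ := mem_locus.1 h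
    exact ⟨_, Or.inl ⟨l, hl, rfl⟩, hη⟩
  · exact ⟨_, Or.inr ⟨η, ⟨hη, h⟩, rfl⟩, mem_connectedComponentIn ⟨hη, h⟩⟩

/-! ### The bending lamination -/

/-- The part of the disk over which the envelope agrees with an affine function. -/
def zone (s : Side) (φ : Circle → ℝ) (σ : Mink) : Set ℂ := {η | η ∈ disk ∧ Supp s φ σ η}

/-- The part of the disk near which the envelope is affine. -/
def flatPart (s : Side) (φ : Circle → ℝ) : Set ℂ := ⋃ σ, interior (zone s φ σ)

/-- The bending lamination of the lower convex envelope. -/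
def bending (s : Side) (φ : Circle → ℝ) : Set Geodesic :=
  {l | (∃ σ, ∀ η ∈ l.carrier, Supp s φ σ η) ∧ Disjoint l.carrier (flatPart s φ)}

variable {s : Side} {φ : Circle → ℝ}

theorem convex_zone (σ : Mink) : Convex ℝ (zone s φ σ) := fun _ hx _ hy _ _ ha hb hab =>
  ⟨convex_disk hx.1 hy.1 ha hb hab, hx.2.1, convex_convexHull ℝ _ hx.2.2 hy.2.2 ha hb hab⟩

theorem mem_flatPart {η : ℂ} : η ∈ flatPart s φ ↔ ∃ σ, η ∈ interior (zone s φ σ) := by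
  simp [flatPart]

theorem isOpen_flatPart : IsOpen (flatPart s φ) := isOpen_iUnion fun _ => isOpen_interior

theorem flatPart_subset_disk : flatPart s φ ⊆ disk :=
  iUnion_subset fun _ => interior_subset.trans fun _ h => h.1

theorem interior_convexHull_subset_zone {σ : Mink} (hσ : Below s φ σ) :
    interior (convexHull ℝ (contact s φ σ)) ⊆ interior (zone s φ σ) := by
  refine interior_maximal (fun η hη => ⟨?_, hσ, interior_subset hη⟩) isOpen_interior
  have h1 : convexHull ℝ (contact s φ σ) ⊆ Metric.closedBall (0 : ℂ) 1 :=
    convexHull_min (fun z hz => by simp [norm_of_mem_contact hz]) (convex_closedBall _ _)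
  have h2 := interior_mono h1 hη
  rwa [interior_closedBall (0 : ℂ) one_ne_zero] at h2

/-- Near η the envelope is the function of σ, so the function of τ - σ has a local maximum of value
zero at η. -/
theorem Supp.eq_of_mem_interior {σ τ : Mink} {η : ℂ} (hτ : Supp s φ τ η)
    (hη : η ∈ interior (zone s φ σ)) : τ = σ := by
  have hσ := (interior_subset hη).2
  refine sub_eq_zero.1 (eq_zero_of_aff_nonpos (s := s) (η := η) ?_ ?_)
  · rw [aff_sub, ← hτ.env_eq, ← hσ.env_eq, sub_self]
  · filter_upwards [mem_interior_iff_mem_nhds.1 hη] with ζ hζ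
    rw [aff_sub]
    linarith [hζ.2.aff_le hτ.1]

theorem aff_left_eq_of_eqOn_openSegment {v : ℂ → ℝ} {p q : Circle} (hpq : p ≠ q)
    (hv : Tendsto v (𝓝[disk] (p : ℂ)) (𝓝 (φ p))) {σ : Mink}
    (h : ∀ η ∈ openSegment ℝ (p : ℂ) q, aff s σ η = v η) : aff s σ p = φ p := by
  let c : ℝ → ℂ := fun t => (1 - t) • (p : ℂ) + t • (q : ℂ)
  have hc : Continuous c := by fun_prop
  have hc0 : c 0 = p := by simp [c]
  have hmem : ∀ᶠ t in 𝓝[>] (0 : ℝ), c t ∈ openSegment ℝ (p : ℂ) q := by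
    filter_upwards [Ioo_mem_nhdsGT (zero_lt_one' ℝ)] with t ht
    exact ⟨1 - t, t, sub_pos.2 ht.2, ht.1, by ring, rfl⟩
  have ht : Tendsto c (𝓝[>] 0) (𝓝 (p : ℂ)) := hc0 ▸ (hc.tendsto 0).mono_left nhdsWithin_le_nhds
  have ht' : Tendsto c (𝓝[>] 0) (𝓝[disk] (p : ℂ)) := tendsto_nhdsWithin_iff.2
    ⟨ht, hmem.mono fun t h => openSegment_circle_subset_disk hpq h⟩
  refine tendsto_nhds_unique (((continuous_aff_right s σ).tendsto _).comp ht)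
    ((hv.comp ht').congr' ?_)
  filter_upwards [hmem] with t ht
  exact (h _ ht).symm

theorem aff_eq_of_eqOn_openSegment {v : ℂ → ℝ} {p q : Circle} (hpq : p ≠ q)
    (hv : ∀ z : Circle, Tendsto v (𝓝[disk] (z : ℂ)) (𝓝 (φ z))) {σ : Mink}
    (h : ∀ η ∈ openSegment ℝ (p : ℂ) q, aff s σ η = v η) :
    aff s σ p = φ p ∧ aff s σ q = φ q :=
  ⟨aff_left_eq_of_eqOn_openSegment hpq (hv p) h,
    aff_left_eq_of_eqOn_openSegment hpq.symm (hv q) (by rwa [openSegment_symm])⟩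

theorem supp_carrier_iff (hφ : Continuous φ) {p q : Circle} (h : p ≠ q) {σ : Mink} :
    (∀ η ∈ (Geodesic.mk h).carrier, Supp s φ σ η) ↔
      Below s φ σ ∧ aff s σ p = φ p ∧ aff s σ q = φ q := by
  refine ⟨fun hσ => ⟨?_, ?_⟩, fun hσ η hη => supp_of_mem_openSegment hσ.1 hσ.2.1 hσ.2.2 hη⟩
  · obtain ⟨η, hη⟩ := (Geodesic.mk h).carrier_nonempty
    exact (hσ η hη).1
  · exact aff_eq_of_eqOn_openSegment h (tendsto_env hφ) fun η hη => (hσ η hη).env_eq.symm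

/-- Support planes along a leaf of the bending lamination are support planes at any of its
points. -/
theorem Supp.of_mem_carrier (hφ : Continuous φ) {l : Geodesic} (hl : l ∈ bending s φ) {σ : Mink}
    {η ζ : ℂ} (hη : η ∈ l.carrier) (hζ : ζ ∈ l.carrier) (h : Supp s φ σ η) : Supp s φ σ ζ := by
  obtain ⟨p, q, hpq, rfl⟩ := l.exists_mk
  obtain ⟨⟨τ, hτ⟩, -⟩ := hl
  have hτ' := (supp_carrier_iff hφ hpq).1 hτ
  refine (supp_carrier_iff hφ hpq).2 ⟨h.1, contact_of_mem_openSegment hη hτ'.2.1 hτ'.2.2 h.1 ?_⟩ ζ hζ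
  exact h.aff_le hτ'.1

theorem exists_contact_or_mem_interior {σ : Mink} {η : ℂ} (hη : η ∈ disk) (h : Supp s φ σ η) :
    (∃ p q : Circle, p ≠ q ∧ η ∈ openSegment ℝ (p : ℂ) q ∧ aff s σ p = φ p ∧ aff s σ q = φ q) ∨
      η ∈ interior (zone s φ σ) := by
  rcases mem_openSegment_or_mem_interior_convexHull (fun z hz => norm_of_mem_contact hz) hη h.2 with
    ⟨_, ⟨p, hp, rfl⟩, _, ⟨q, hq, rfl⟩, hpq, hη⟩ | hη
  · exact Or.inl ⟨p, q, fun e => hpq (congrArg _ e), hη, hp, hq⟩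
  · exact Or.inr (interior_convexHull_subset_zone h.1 hη)

/-- Take the contact chord through η. If it met the interior of a zone, convexity of the zone would
spread that interior along the whole open chord, making η flat. -/
theorem exists_mem_bending (hφ : Continuous φ) {η : ℂ} (hη : η ∈ disk) (hf : η ∉ flatPart s φ) :
    ∃ l ∈ bending s φ, η ∈ l.carrier := by
  obtain ⟨σ, hσ⟩ := exists_supp (s := s) hφ hη
  obtain ⟨p, q, hpq, hηl, hp, hq⟩ | h := exists_contact_or_mem_interior hη hσ
  swap
  · exact absurd (mem_flatPart.2 ⟨σ, h⟩) hf
  have hsupp := (supp_carrier_iff hφ hpq).2 ⟨hσ.1, hp, hq⟩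
  refine ⟨Geodesic.mk hpq, ⟨⟨σ, hsupp⟩, ?_⟩, hηl⟩
  rw [Set.disjoint_left]
  intro ζ hζ hζf
  obtain ⟨τ, hτ⟩ := mem_flatPart.1 hζf
  obtain rfl := (hsupp ζ hζ).eq_of_mem_interior hτ
  have hsub : openSegment ℝ (p : ℂ) q ⊆ zone s φ σ := fun x hx =>
    ⟨openSegment_circle_subset_disk hpq hx, hsupp x hx⟩
  have hcl : segment ℝ (p : ℂ) q ⊆ closure (zone s φ σ) := by
    rw [← closure_openSegment]
    exact closure_mono hsub
  have hint : ∀ y ∈ closure (zone s φ σ), openSegment ℝ ζ y ⊆ interior (zone s φ σ) := fun y hy =>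
    (convex_zone σ).openSegment_interior_closure_subset_interior hτ hy
  -- Splits the chord at ζ; the weights re-express η between ζ and one endpoint.
  have hηm : η = ζ ∨ η ∈ openSegment ℝ ζ (p : ℂ) ∨ η ∈ openSegment ℝ ζ (q : ℂ) := by
    obtain ⟨a, b, ha, hb, hab, rfl⟩ := hηl
    obtain ⟨c, d, hc, hd, hcd, rfl⟩ := hζ
    obtain rfl : a = 1 - b := by linarith
    obtain rfl : c = 1 - d := by linarith
    rcases lt_trichotomy b d with h | h | h
    · refine Or.inr (Or.inl ⟨b / d, 1 - b / d, div_pos hb hd,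
        sub_pos.2 ((div_lt_one hd).2 h), by ring, ?_⟩)
      have e : b / d * d = b := div_mul_cancel₀ _ hd.ne'
      have e1 : b / d * (1 - d) + (1 - b / d) = 1 - b := by linear_combination -e
      rw [smul_add, smul_smul, smul_smul, e, add_right_comm, ← add_smul, e1]
    · exact Or.inl (by rw [h])
    · have hne : 1 - d ≠ 0 := hc.ne'
      refine Or.inr (Or.inr ⟨(1 - b) / (1 - d), 1 - (1 - b) / (1 - d), div_pos ha hc,
        sub_pos.2 ((div_lt_one hc).2 (by linarith)), by ring, ?_⟩)
      have e : (1 - b) / (1 - d) * (1 - d) = 1 - b := div_mul_cancel₀ _ hne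
      have e1 : (1 - b) / (1 - d) * d + (1 - (1 - b) / (1 - d)) = b := by linear_combination -e
      rw [smul_add, smul_smul, smul_smul, e, add_assoc, ← add_smul, e1]
  refine hf (mem_flatPart.2 ⟨σ, ?_⟩)
  rcases hηm with rfl | h | h
  · exact hτ
  · exact hint _ (hcl (left_mem_segment _ _ _)) h
  · exact hint _ (hcl (right_mem_segment _ _ _)) h

theorem locus_bending (hφ : Continuous φ) : locus (bending s φ) = disk \ flatPart s φ := by
  ext η
  rw [mem_locus]
  constructor
  · rintro ⟨l, hl, hη⟩
    exact ⟨l.carrier_subset_disk hη, Set.disjoint_left.1 hl.2 hη⟩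
  · rintro ⟨h1, h2⟩
    exact exists_mem_bending hφ h1 h2

theorem disk_diff_locus_bending (hφ : Continuous φ) :
    disk \ locus (bending s φ) = flatPart s φ := by
  rw [locus_bending hφ, sdiff_sdiff_cancel_left flatPart_subset_disk]

theorem eq_of_mem_bending (hφ : Continuous φ) {l l' : Geodesic} (hl : l ∈ bending s φ)
    (hl' : l' ∈ bending s φ) {η : ℂ} (hη : η ∈ l.carrier) (hη' : η ∈ l'.carrier) : l = l' := by
  obtain ⟨⟨σ, hσ⟩, hd⟩ := hl
  have hσ' : ∀ ζ ∈ l'.carrier, Supp s φ σ ζ := fun ζ hζ =>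
    (hσ η hη).of_mem_carrier hφ hl' hη' hζ
  obtain ⟨p, q, hpq, rfl⟩ := l.exists_mk
  obtain ⟨p', q', hpq', rfl⟩ := l'.exists_mk
  obtain ⟨hB, hp, hq⟩ := (supp_carrier_iff hφ hpq).1 hσ
  obtain ⟨-, hp', hq'⟩ := (supp_carrier_iff hφ hpq').1 hσ'
  refine Geodesic.eq_of_mem_of_mem (fun z hz => norm_of_mem_contact hz) (coe_mem_contact.2 hp)
    (coe_mem_contact.2 hq) (coe_mem_contact.2 hp') (coe_mem_contact.2 hq') hη hη' fun hint => ?_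
  exact Set.disjoint_left.1 hd hη
    (mem_flatPart.2 ⟨σ, interior_convexHull_subset_zone hB hint⟩)

theorem isClosed_bending (hφ : Continuous φ) : IsClosed (bending s φ) := by
  rw [← isClosed_setOf_mk_mem]
  let mid : {p : Circle × Circle // p.1 ≠ p.2} → ℂ := fun x =>
    (1 / 2 : ℝ) • (x.1.1 : ℂ) + (1 / 2 : ℝ) • (x.1.2 : ℂ)
  have hmid : Continuous mid := by fun_prop
  have hmidl (x) : mid x ∈ (Geodesic.mk x.2).carrier :=
    ⟨1 / 2, 1 / 2, by norm_num, by norm_num, by norm_num, rfl⟩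
  -- A common support plane along the chord exists exactly when the envelope at its midpoint is the
  -- mean of the two boundary values, and this is a closed condition.
  have hset : {x : {p : Circle × Circle // p.1 ≠ p.2} | Geodesic.mk x.2 ∈ bending s φ} =
      {x | env s φ (mid x) = (φ x.1.1 + φ x.1.2) / 2} ∩
        ⋂ t ∈ Ioo (0 : ℝ) 1, {x | (1 - t) • (x.1.1 : ℂ) + t • (x.1.2 : ℂ) ∉ flatPart s φ} := by
    ext x
    simp only [mem_ofPred_eq, mem_inter_iff, mem_iInter]
    refine and_congr ⟨?_, fun h => ?_⟩ ⟨fun h t ht => ?_, fun h => ?_⟩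
    · rintro ⟨σ, hσ⟩
      obtain ⟨-, hp, hq⟩ := (supp_carrier_iff hφ x.2).1 hσ
      rw [(hσ _ (hmidl x)).env_eq, aff_combo s σ (by norm_num), hp, hq]
      ring
    · obtain ⟨σ, hσ⟩ := exists_supp (s := s) hφ ((Geodesic.mk x.2).carrier_subset_disk (hmidl x))
      rw [hσ.env_eq, aff_combo s σ (by norm_num)] at h
      refine ⟨σ, (supp_carrier_iff hφ x.2).2 ⟨hσ.1, ?_, ?_⟩⟩ <;>
        linarith [hσ.1 x.1.1, hσ.1 x.1.2]
    · exact Set.disjoint_left.1 h ⟨1 - t, t, sub_pos.2 ht.2, ht.1, by ring, rfl⟩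
    · rw [Set.disjoint_left]
      rintro _ ⟨a, b, ha, hb, hab, rfl⟩
      have := h b ⟨hb, by linarith⟩
      rwa [← hab, add_sub_cancel_right] at this
  rw [hset]
  refine IsClosed.inter (isClosed_eq ?_ (by fun_prop)) (isClosed_biInter fun t _ => ?_)
  · exact (continuousOn_env hφ).comp_continuous hmid
      fun x => (Geodesic.mk x.2).carrier_subset_disk (hmidl x)
  · exact (isOpen_flatPart.isClosed_compl).preimage
      (by fun_prop : Continuous fun x : {p : Circle × Circle // p.1 ≠ p.2} =>
        (1 - t) • (x.1.1 : ℂ) + t • (x.1.2 : ℂ))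

theorem isLamination_bending (hφ : Continuous φ) : IsLamination (bending s φ) := by
  refine ⟨isClosed_bending hφ, fun l hl l' hl' hne => ?_⟩
  rw [Function.onFun, Set.disjoint_left]
  exact fun η hη hη' => hne (eq_of_mem_bending hφ hl hl' hη hη')

/-- Interiors of zones are convex, and by uniqueness of support planes they are disjoint for
different σ. -/
theorem connectedComponentIn_flatPart {σ : Mink} {η : ℂ} (hη : η ∈ interior (zone s φ σ)) :
    connectedComponentIn (flatPart s φ) η = interior (zone s φ σ) := by
  have hsub : interior (zone s φ σ) ⊆ flatPart s φ := fun ζ hζ => mem_flatPart.2 ⟨σ, hζ⟩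
  apply Subset.antisymm
  · refine isPreconnected_connectedComponentIn.subset_left_of_subset_union isOpen_interior
      (v := ⋃ τ ∈ {τ | τ ≠ σ}, interior (zone s φ τ))
      (isOpen_biUnion fun _ _ => isOpen_interior) ?_ ?_
      ⟨η, mem_connectedComponentIn (hsub hη), hη⟩
    · rw [Set.disjoint_left]
      intro ζ hζ hζ'
      simp only [mem_iUnion] at hζ'
      obtain ⟨τ, hτ, hζτ⟩ := hζ'
      exact hτ ((interior_subset hζτ).2.eq_of_mem_interior hζ)
    · refine (connectedComponentIn_subset _ _).trans fun ζ hζ => ?_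
      obtain ⟨τ, hτ⟩ := mem_flatPart.1 hζ
      by_cases h : τ = σ
      · exact Or.inl (h ▸ hτ)
      · refine Or.inr ?_
        simp only [mem_iUnion]
        exact ⟨τ, h, hτ⟩
  · exact (convex_zone σ).interior.isPreconnected.subset_connectedComponentIn hη hsub

theorem isGap_bending_iff (hφ : Continuous φ) {G : Set ℂ} :
    IsGap (bending s φ) G ↔ ∃ σ, G = interior (zone s φ σ) ∧ G.Nonempty := by
  rw [IsGap, disk_diff_locus_bending hφ]
  constructor
  · rintro ⟨η, hη, rfl⟩
    obtain ⟨σ, hσ⟩ := mem_flatPart.1 hη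
    exact ⟨σ, connectedComponentIn_flatPart hσ, η, mem_connectedComponentIn hη⟩
  · rintro ⟨σ, rfl, η, hη⟩
    exact ⟨η, mem_flatPart.2 ⟨σ, hη⟩, (connectedComponentIn_flatPart hη).symm⟩

theorem Supp.of_mem_stratum (hφ : Continuous φ) {S : Set ℂ} (hS : IsStratum (bending s φ) S)
    {σ : Mink} {η ζ : ℂ} (hη : η ∈ S) (hζ : ζ ∈ S) (h : Supp s φ σ η) : Supp s φ σ ζ := by
  obtain ⟨l, hl, rfl⟩ | hG := hS
  · exact h.of_mem_carrier hφ hl hη hζ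
  · obtain ⟨τ, rfl, -⟩ := (isGap_bending_iff hφ).1 hG
    obtain rfl := h.eq_of_mem_interior hη
    exact (interior_subset hζ).2

/-- If the zone of σ has interior, this interior is a gap whose closure contains both strata. If
not, both strata are leaves, and σ cannot touch φ at a third point since the triangle would give
interior, so the leaves coincide. -/
theorem exists_subset_closure (hφ : Continuous φ) {S S' : Set ℂ}
    (hS : IsStratum (bending s φ) S) (hS' : IsStratum (bending s φ) S') {σ : Mink}
    (h : ∀ η ∈ S, Supp s φ σ η) (h' : ∀ η ∈ S', Supp s φ σ η) :
    ∃ T, IsStratum (bending s φ) T ∧ S ⊆ closure T ∧ S' ⊆ closure T := by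
  rcases (interior (zone s φ σ)).eq_empty_or_nonempty with hemp | hne
  swap
  · have hcl : closure (interior (zone s φ σ)) = closure (zone s φ σ) :=
      (convex_zone σ).closure_interior_eq_closure_of_nonempty_interior hne
    refine ⟨interior (zone s φ σ), Or.inr ((isGap_bending_iff hφ).2 ⟨σ, rfl, hne⟩), ?_, ?_⟩ <;>
      rw [hcl]
    · exact fun η hη => subset_closure ⟨hS.subset_disk hη, h η hη⟩
    · exact fun η hη => subset_closure ⟨hS'.subset_disk hη, h' η hη⟩
  · have hleaf : ∀ S, IsStratum (bending s φ) S → (∀ η ∈ S, Supp s φ σ η) →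
        ∃ l ∈ bending s φ, S = l.carrier := by
      rintro S (hl | hG) h
      · exact hl
      · obtain ⟨τ, rfl, η, hη⟩ := (isGap_bending_iff hφ).1 hG
        obtain rfl := (h η hη).eq_of_mem_interior hη
        exact absurd hη (by simp [hemp])
    obtain ⟨l, hl, rfl⟩ := hleaf S hS h
    obtain ⟨l', hl', rfl⟩ := hleaf S' hS' h'
    suffices l = l' from ⟨_, hS, subset_closure, this ▸ subset_closure⟩
    obtain ⟨p, q, hpq, rfl⟩ := l.exists_mk
    obtain ⟨p', q', hpq', rfl⟩ := l'.exists_mk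
    obtain ⟨hB, hp, hq⟩ := (supp_carrier_iff hφ hpq).1 h
    obtain ⟨-, hp', hq'⟩ := (supp_carrier_iff hφ hpq').1 h'
    have key : ∀ r : Circle, aff s σ r = φ r → r = p ∨ r = q := by
      intro r hr
      by_contra! hne
      have := nonempty_interior_convexHull_triple p.norm_coe q.norm_coe r.norm_coe
        (Circle.coe_injective.ne hpq) (Circle.coe_injective.ne hne.1.symm)
        (Circle.coe_injective.ne hne.2.symm)
      have hsub : ({(p : ℂ), (q : ℂ), (r : ℂ)} : Set ℂ) ⊆ contact s φ σ := by
        rintro _ (rfl | rfl | rfl)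
        exacts [coe_mem_contact.2 hp, coe_mem_contact.2 hq, coe_mem_contact.2 hr]
      have := (this.mono (interior_mono (convexHull_mono hsub))).mono
        (interior_convexHull_subset_zone hB)
      rw [hemp] at this
      exact this.ne_empty rfl
    refine Quotient.sound ?_
    rcases key p' hp' with rfl | rfl <;> rcases key q' hq' with rfl | rfl
    · exact absurd rfl hpq'
    · exact Or.inl rfl
    · exact Or.inr rfl
    · exact absurd rfl hpq'

end InfEarthquake

namespace InfEarthquake

/-! ### The field of support planes -/

/-- The field `η ↦ (1 - |η|²) ∇ + u(η) η` of a family of affine functions; up to a rotation by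
`±π / 2`, it is the vector field of the corresponding Killing fields. -/
noncomputable def normalField (s : Side) (σ : Mink) (η : ℂ) : ℂ :=
  (1 - ‖η‖ ^ 2) • grad s σ + aff s σ η • η

theorem killing_eq_normalField (s : Side) (σ : Mink) (η : ℂ) :
    killing σ η = s.sign • (Complex.I * normalField s σ η) := by
  simp only [killing_eq s, normalField, Complex.real_smul]

theorem normalField_eq_killing (s : Side) (σ : Mink) (η : ℂ) :
    normalField s σ η = s.sign • (-Complex.I * killing σ η) := by
  rw [killing_eq_normalField s, mul_smul_comm, smul_smul, s.sign_mul_self, one_smul, ← mul_assoc,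
    neg_mul, Complex.I_mul_I, neg_neg, one_mul]

theorem continuous_killing : Continuous fun p : Mink × ℂ => killing p.1 p.2 := by
  have h := continuous_aff .left
  have h' := continuous_grad .left
  simp only [killing_eq_normalField .left, normalField]
  fun_prop

/-- The support function of a field on the circle, with the sign of the side. -/
noncomputable def bd (s : Side) (X : Circle → ℂ) (z : Circle) : ℝ := s.sign * supportFun X z

theorem continuous_bd {X : Circle → ℂ} (hX : Continuous X) (s : Side) : Continuous (bd s X) := by
  unfold bd supportFun
  fun_prop

theorem IsTangent.eq_smul {X : Circle → ℂ} (hX : IsTangent X) (s : Side) (z : Circle) :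
    X z = s.sign • (Complex.I * (bd s X z • (z : ℂ))) := by
  have h := hX z
  have hz := circle_sq z
  rw [bd, mul_smul, mul_smul_comm, smul_smul, s.sign_mul_self, one_smul, supportFun]
  simp only [Complex.inner, Complex.mul_re, Complex.conj_re, Complex.conj_im] at h
  apply Complex.ext
  · simp [Complex.inner]
    linear_combination (z : ℂ).re * h - (X z).re * hz
  · simp [Complex.inner]
    linear_combination (z : ℂ).im * h - (X z).im * hz

theorem extendsTo_iff {X : Circle → ℂ} (hX : IsTangent X) (s : Side) {E : disk → ℂ} {m : ℂ → Mink}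
    (hE : ∀ η : disk, E η = killing (m η) η) :
    ExtendsTo E X ↔ ∀ z : Circle,
      Tendsto (fun η => normalField s (m η) η) (𝓝[disk] (z : ℂ)) (𝓝 (bd s X z • (z : ℂ))) := by
  refine forall_congr' fun z => ?_
  have hl : 𝓝[disk] (z : ℂ) = map (fun η : disk => (η : ℂ)) (comap (fun η : disk => (η : ℂ)) (𝓝 z)) := by
    rw [Filter.map_comap, Subtype.range_coe, nhdsWithin]
  rw [hl, tendsto_map'_iff]
  constructor
  · intro h
    have h1 := (h.const_mul (-Complex.I)).const_smul s.sign
    rw [hX.eq_smul s z, mul_smul_comm, smul_smul, s.sign_mul_self, one_smul, ← mul_assoc,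
      neg_mul, Complex.I_mul_I, neg_neg, one_mul] at h1
    refine h1.congr fun η => ?_
    rw [hE, Function.comp_apply, normalField_eq_killing]
  · intro h
    have h1 := (h.const_mul Complex.I).const_smul s.sign
    rw [hX.eq_smul s z]
    refine h1.congr fun η => ?_
    rw [hE, Function.comp_apply, killing_eq_normalField s]

variable {s : Side} {φ : Circle → ℝ}

theorem tendsto_normalField (hφ : Continuous φ) {m : ℂ → Mink}
    (hm : ∀ η ∈ disk, Supp s φ (m η) η) (z : Circle) :
    Tendsto (fun η => normalField s (m η) η) (𝓝[disk] (z : ℂ)) (𝓝 (φ z • (z : ℂ))) := by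
  have h1 : Tendsto (fun η => (1 - ‖η‖ ^ 2) • grad s (m η)) (𝓝[disk] (z : ℂ)) (𝓝 0) := by
    rw [Metric.tendsto_nhds]
    intro ε hε
    filter_upwards [eventually_supp (s := s) hφ z (half_pos hε), self_mem_nhdsWithin] with η h hη
    have h1 := (h _ (hm η hη)).2
    have h2 := mem_disk.1 hη
    have h3 : 0 ≤ 1 - ‖η‖ ^ 2 := by nlinarith [norm_nonneg η]
    rw [dist_zero_right, norm_smul, Real.norm_of_nonneg h3]
    have : (1 - ‖η‖ ^ 2) * ‖grad s (m η)‖ = (1 + ‖η‖) * ((1 - ‖η‖) * ‖grad s (m η)‖) := by ring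
    have h4 : 0 ≤ (1 - ‖η‖) * ‖grad s (m η)‖ := mul_nonneg (by linarith) (norm_nonneg _)
    nlinarith
  have h2 : Tendsto (fun η => aff s (m η) η • η) (𝓝[disk] (z : ℂ)) (𝓝 (φ z • (z : ℂ))) := by
    refine Tendsto.smul ?_ (tendsto_id.mono_left nhdsWithin_le_nhds)
    refine (tendsto_env (s := s) hφ z).congr' ?_
    filter_upwards [self_mem_nhdsWithin] with η hη
    exact (hm η hη).env_eq
  simpa [normalField] using h1.add h2

/-- On each stratum of the bending lamination, the field agrees with the Killing field of a support
plane of that stratum. -/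
def Adapted (s : Side) (φ : Circle → ℝ) (E : disk → ℂ) : Prop :=
  ∀ S, IsStratum (bending s φ) S → ∃ σ, ∀ η : disk, (η : ℂ) ∈ S →
    Supp s φ σ η ∧ E η = killing σ η

/-- On its own stratum each support plane dominates the other, which fixes both signs of the
difference. A zero in between exists by continuity and makes the difference hyperbolic. -/
theorem Adapted.isInfEarthquake (hφ : Continuous φ) {E : disk → ℂ} (hE : Adapted s φ E) :
    IsInfEarthquake s (bending s φ) E := by
  choose! κ hκ using hE
  have hs : ∀ S, IsStratum (bending s φ) S → ∀ η ∈ S, Supp s φ (κ S) η := fun S hS η hη =>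
    (hκ S hS ⟨η, hS.subset_disk hη⟩ hη).1
  refine ⟨κ, fun S hS η hη => (hκ S hS η hη).2, fun S S' hS hS' => ⟨fun h => ?_, fun h => ?_⟩⟩
  · have e := sub_eq_zero.1 h
    exact exists_subset_closure hφ hS hS' (hs S hS) (e ▸ hs S' hS')
  · have h1 : ∀ η ∈ S, aff s (κ S' - κ S) η ≤ 0 := fun η hη => by
      obtain ⟨x, hx⟩ := hS'.nonempty
      rw [aff_sub]
      linarith [(hs S hS η hη).aff_le (hs S' hS' x hx).1]
    have h2 : ∀ η ∈ S', 0 ≤ aff s (κ S' - κ S) η := fun η hη => by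
      obtain ⟨x, hx⟩ := hS.nonempty
      rw [aff_sub]
      linarith [(hs S' hS' η hη).aff_le (hs S hS x hx).1]
    obtain ⟨x, hx⟩ := hS.nonempty
    obtain ⟨y, hy⟩ := hS'.nonempty
    obtain ⟨ζ, hζ, hζ0⟩ := convex_disk.isPreconnected.intermediate_value (hS.subset_disk hx)
      (hS'.subset_disk hy) (continuous_aff_right s (κ S' - κ S)).continuousOn
      ⟨h1 x hx, h2 y hy⟩
    have hyp := isHyperbolic_of_mink_lift_eq_zero h hζ ((aff_eq_zero_iff s _ _).1 hζ0)
    exact ⟨hyp, weaklySeparates_of_nonpos_of_nonneg h1 h2, translates_of_nonpos_of_nonneg hyp h1 h2⟩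

theorem Adapted.exists_supp_field {E : disk → ℂ} (hE : Adapted s φ E) :
    ∃ m : ℂ → Mink, (∀ η ∈ disk, Supp s φ (m η) η) ∧ ∀ η : disk, E η = killing (m η) η := by
  have h : ∀ η : ℂ, ∃ σ : Mink, ∀ hη : η ∈ disk, Supp s φ σ η ∧ E ⟨η, hη⟩ = killing σ η := by
    intro η
    by_cases hη : η ∈ disk
    · obtain ⟨S, hS, hηS⟩ := exists_isStratum (bending s φ) hη
      obtain ⟨σ, hσ⟩ := hE S hS
      exact ⟨σ, fun _ => hσ ⟨η, hη⟩ hηS⟩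
    · exact ⟨0, fun h => absurd h hη⟩
  choose m hm using h
  exact ⟨m, fun η hη => (hm η hη).1, fun η => (hm η η.2).2⟩

theorem Adapted.extendsTo {X : Circle → ℂ} (hX : Continuous X) (hT : IsTangent X) {E : disk → ℂ}
    (hE : Adapted s (bd s X) E) : ExtendsTo E X := by
  obtain ⟨m, hm, hEm⟩ := hE.exists_supp_field
  exact (extendsTo_iff hT s hEm).2 (tendsto_normalField (continuous_bd hX s) hm)

/-! ### The support planes at a point -/

theorem convex_supp (hφ : Continuous φ) {η : ℂ} (hη : η ∈ disk) : Convex ℝ {σ | Supp s φ σ η} := by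
  intro σ hσ τ hτ a b ha hb hab
  rw [mem_ofPred_eq, supp_iff hφ hη] at *
  refine ⟨fun z => ?_, ?_⟩
  · rw [aff_add, aff_smul, aff_smul, ← one_mul (φ z), ← hab, add_mul]
    exact add_le_add (mul_le_mul_of_nonneg_left (hσ.1 z) ha) (mul_le_mul_of_nonneg_left (hτ.1 z) hb)
  · rw [aff_add, aff_smul, aff_smul, hσ.2, hτ.2, ← add_mul, hab, one_mul]

/-- If η lies on a contact chord, all support planes at η agree at its ends, so they differ by
multiples of `chordFun`: they form a compact convex subset of a line. Otherwise the support plane is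
unique. -/
theorem exists_supp_eq_segment (hφ : Continuous φ) {η : ℂ} (hη : η ∈ disk) :
    ∃ σ₁ σ₂ : Mink, {σ | Supp s φ σ η} = segment ℝ σ₁ σ₂ := by
  obtain ⟨σ₀, h₀⟩ := exists_supp (s := s) hφ hη
  by_cases hsub : ∀ σ, Supp s φ σ η → σ = σ₀
  · refine ⟨σ₀, σ₀, ?_⟩
    rw [segment_same]
    exact Set.ext fun σ => ⟨hsub σ, fun h => by rw [mem_singleton_iff.1 h]; exact h₀⟩
  push Not at hsub
  obtain ⟨σ₁, h₁, hne⟩ := hsub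
  obtain ⟨p, q, hpq, hηl, hp, hq⟩ | h := exists_contact_or_mem_interior hη h₀
  swap
  · exact absurd (h₁.eq_of_mem_interior h) hne
  have hchord : ∀ σ, Supp s φ σ η → ∃ c : ℝ, ∀ w, aff s (σ - σ₀) w = c * chordFun p q w := by
    intro σ hσ
    obtain ⟨hp', hq'⟩ := contact_of_mem_openSegment hηl hp hq hσ.1 (hσ.aff_le h₀.1)
    exact exists_aff_eq_mul_chordFun (Circle.coe_injective.ne hpq)
      (by rw [aff_sub, hp, hp', sub_self]) (by rw [aff_sub, hq, hq', sub_self])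
  obtain ⟨c₁, hc₁⟩ := hchord σ₁ h₁
  obtain ⟨e, he⟩ : ∃ e, aff s (σ₁ - σ₀) e ≠ 0 := by
    by_contra! h
    exact hne (sub_eq_zero.1 (eq_zero_of_aff_eq_zero h))
  have he' := he
  rw [hc₁] at he'
  -- Coordinate on that line, read off at a point e where σ₁ and σ₀ differ.
  let g : Mink → ℝ := fun σ => aff s (σ - σ₀) e / aff s (σ₁ - σ₀) e
  have hg : Continuous g :=
    ((continuous_aff_left s e).comp (continuous_id.sub continuous_const)).div_const _
  let f : ℝ →ᵃ[ℝ] Mink := AffineMap.lineMap σ₀ σ₁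
  have hfg : ∀ σ, Supp s φ σ η → f (g σ) = σ := by
    intro σ hσ
    obtain ⟨c, hc⟩ := hchord σ hσ
    have hgc : g σ * c₁ = c := by
      simp only [g, hc, hc₁]
      rw [mul_div_mul_right _ _ (right_ne_zero_of_mul he'),
        div_mul_cancel₀ _ (left_ne_zero_of_mul he')]
    have hz : (σ - σ₀) - g σ • (σ₁ - σ₀) = 0 := by
      refine eq_zero_of_aff_eq_zero (s := s) fun w => ?_
      rw [aff_sub, aff_smul, hc, hc₁, ← mul_assoc, hgc, sub_self]
    simp only [f, AffineMap.lineMap_apply_module']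
    rw [← sub_eq_zero.1 hz, sub_add_cancel]
  have hW := (isCompact_supp (s := s) hφ hη).image hg
  have hWc : IsConnected (g '' {σ | Supp s φ σ η}) :=
    ⟨⟨_, σ₀, h₀, rfl⟩, (convex_supp hφ hη).isPreconnected.image g hg.continuousOn⟩
  have hIcc := eq_Icc_of_connected_compact hWc hW
  set a := sInf (g '' {σ | Supp s φ σ η})
  set b := sSup (g '' {σ | Supp s φ σ η})
  have hab : a ≤ b := nonempty_Icc.1 (hIcc ▸ hWc.nonempty)
  refine ⟨f a, f b, ?_⟩
  rw [← image_segment, segment_eq_Icc hab, ← hIcc, image_image]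
  ext σ
  constructor
  · exact fun h => ⟨σ, h, hfg σ h⟩
  · rintro ⟨τ, hτ, rfl⟩
    change f (g τ) ∈ _
    rwa [hfg τ hτ]

theorem isSupportPlane_iff {X : Circle → ℂ} {η : ℂ} {σ : Mink} :
    IsSupportPlane s X η σ ↔ Supp s (bd s X) σ η := by
  have hrefl : ∀ p ∈ hull X,
      (p.1, s.sign * p.2) ∈ convexHull ℝ (range fun z : Circle => ((z : ℂ), bd s X z)) := by
    intro p hp
    let T : ℂ × ℝ →ₗ[ℝ] ℂ × ℝ := LinearMap.prodMap LinearMap.id (s.sign • LinearMap.id)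
    have := mem_image_of_mem T hp
    rw [hull, LinearMap.image_convexHull, ← range_comp] at this
    exact this
  constructor
  · rintro ⟨⟨t, ht, hth⟩, hle⟩
    have hB : Below s (bd s X) σ := fun z => by
      have := hle _ (subset_convexHull ℝ _ ⟨z, rfl⟩)
      simp only [mul_sub] at this
      rw [aff, bd]; linarith
    refine ⟨hB, mem_convexHull_contact hB (hrefl _ hth) ?_⟩
    rw [aff, (ht : mink (lift η) σ = t)]
  · intro h
    refine ⟨⟨mink (lift η) σ, rfl, ?_⟩, fun p hp => ?_⟩
    · have hcv : Convex ℝ {w : ℂ | (w, mink (lift w) σ) ∈ hull X} := by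
        intro x hx y hy a b ha hb hab
        have := convex_convexHull ℝ _ hx hy ha hb hab
        have e := aff_combo .left σ (x := x) (y := y) hab
        simp only [aff, Side.sign, one_mul] at e
        rw [mem_ofPred_eq, e]
        exact this
      refine convexHull_min ?_ hcv h.2
      rintro _ ⟨z, hz, rfl⟩
      refine subset_convexHull ℝ _ ⟨z, ?_⟩
      have := mul_left_cancel₀ s.sign_ne_zero (hz : s.sign * _ = s.sign * _)
      simp [this]
    · have := le_of_mem_convexHull_graph h.1 (hrefl p hp)
      rw [aff] at this
      rw [mul_sub]; linarith

/-! ### Continuity of the field of support planes -/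

/-- The envelope is continuous, so continuity of E makes the chosen gradient continuous.
Monotonicity of subgradients along rays from η then leaves room for one subgradient only. -/
theorem eq_of_continuousAt {E : disk → ℂ} {m : disk → Mink}
    (hφ : Continuous φ) (hm : ∀ η : disk, Supp s φ (m η) η) (hE : ∀ η, E η = killing (m η) η)
    {η : disk} (hc : ContinuousAt E η) {σ : Mink} (hσ : Supp s φ σ η) : σ = m η := by
  have hpos (ζ : disk) : 1 - ‖(ζ : ℂ)‖ ^ 2 ≠ 0 := by
    have := mem_disk.1 ζ.2
    nlinarith [norm_nonneg (ζ : ℂ)]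
  have hgrad : (fun ζ => grad s (m ζ)) = fun ζ : disk => (1 - ‖(ζ : ℂ)‖ ^ 2)⁻¹ •
      (s.sign • (-Complex.I * E ζ) - env s φ ζ • (ζ : ℂ)) := by
    funext ζ
    rw [hE, ← normalField_eq_killing, normalField, (hm ζ).env_eq, add_sub_cancel_right, smul_smul,
      inv_mul_cancel₀ (hpos ζ), one_smul]
  have henv : ContinuousAt (fun ζ : disk => env s φ ζ) η :=
    (continuousOn_iff_continuous_domRestrict.1 (continuousOn_env hφ)).continuousAt
  have hcg : ContinuousAt (fun ζ => grad s (m ζ)) η := by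
    rw [hgrad]
    have h1 : ContinuousAt (fun ζ : disk => 1 - ‖(ζ : ℂ)‖ ^ 2) η := by fun_prop
    have h2 : ContinuousAt (fun ζ : disk => s.sign • (-Complex.I * E ζ)) η :=
      (continuousAt_const.mul hc).const_smul s.sign
    exact (h1.inv₀ (hpos η)).smul (h2.sub (henv.smul continuous_subtype_val.continuousAt))
  have key : ∀ n : ℂ, inner ℝ (grad s σ) n ≤ inner ℝ (grad s (m η)) n := by
    intro n
    by_contra! hlt
    have hev : ∀ᶠ ζ in 𝓝 η, inner ℝ (grad s (m ζ)) n < inner ℝ (grad s σ) n :=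
      (hcg.inner continuousAt_const).eventually (gt_mem_nhds hlt)
    rw [nhds_subtype_eq_comap, eventually_comap] at hev
    have hpath : Tendsto (fun t : ℝ => (η : ℂ) + t • n) (𝓝[>] 0) (𝓝 (η : ℂ)) := by
      have : Continuous fun t : ℝ => (η : ℂ) + t • n := by fun_prop
      simpa using (this.tendsto 0).mono_left nhdsWithin_le_nhds
    obtain ⟨t, ⟨h1, h2⟩, ht⟩ := ((hpath.eventually (hev.and (isOpen_disk.mem_nhds η.2))).and
      self_mem_nhdsWithin).exists
    have h3 := h1 ⟨_, h2⟩ rfl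
    set ζ : disk := ⟨(η : ℂ) + t • n, h2⟩
    have h4 := (hm ζ).aff_le hσ.1
    have h5 := hσ.aff_le (hm ζ).1
    have h6 : (ζ : ℂ) - η = t • n := by simp [ζ]
    rw [aff_eq_add s σ η ζ, aff_eq_add s (m ζ) η ζ, h6, inner_smul_right, inner_smul_right] at h4
    have h7 : t * inner ℝ (grad s σ) n ≤ t * inner ℝ (grad s (m ζ)) n := by linarith
    exact h3.not_ge (le_of_mul_le_mul_left h7 ht)
  -- Taking n to be the difference of the gradients forces it to vanish.
  have h0 := key (grad s σ - grad s (m η))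
  rw [← sub_nonpos, ← inner_sub_left, real_inner_self_eq_norm_sq] at h0
  have h1 : grad s σ - grad s (m η) = 0 := by
    rw [← norm_eq_zero]
    exact pow_eq_zero_iff two_ne_zero |>.1 (h0.antisymm (sq_nonneg _))
  have h2 : grad s (σ - m η) = grad s σ - grad s (m η) := by
    apply Complex.ext <;> simp [grad] <;> ring
  refine sub_eq_zero.1 (eq_zero_of_grad_eq_zero (s := s) (η := η) (h2.trans h1) ?_)
  rw [aff_sub, ← hσ.env_eq, ← (hm η).env_eq, sub_self]

/-- Near η the chosen vectors stay in a compact set, and each of their cluster points is a support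
plane at η. Uniqueness there yields convergence. -/
theorem continuousAt_of_forall_eq {E : disk → ℂ} {m : disk → Mink}
    (hφ : Continuous φ) (hm : ∀ η : disk, Supp s φ (m η) η) (hE : ∀ η, E η = killing (m η) η)
    {η : disk} (huniq : ∀ σ, Supp s φ σ η → σ = m η) : ContinuousAt E η := by
  obtain ⟨M, hM⟩ := exists_above hφ
  have henv : ContinuousAt (fun ζ : disk => env s φ ζ) η :=
    (continuousOn_iff_continuous_domRestrict.1 (continuousOn_env hφ)).continuousAt
  have hlow (ζ : disk) : env s φ ζ - (M - env s φ ζ) / (1 - ‖(ζ : ℂ)‖) * ‖(η : ℂ) - ζ‖ ≤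
      aff s (m ζ) η := by
    have h0 : 0 < 1 - ‖(ζ : ℂ)‖ := by linarith [mem_disk.1 ζ.2]
    have h1 := (hm ζ).1.norm_grad_le hM ζ.2
    have h2 : ‖grad s (m ζ)‖ ≤ (M - aff s (m ζ) ζ) / (1 - ‖(ζ : ℂ)‖) := by
      rw [le_div_iff₀ h0]; linarith
    have h3 := neg_le_of_abs_le (abs_real_inner_le_norm (grad s (m ζ)) ((η : ℂ) - ζ))
    have h4 := mul_le_mul_of_nonneg_right h2 (norm_nonneg ((η : ℂ) - ζ))
    rw [(hm ζ).env_eq, aff_eq_add s (m ζ) ζ η]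
    linarith
  have hlim : Tendsto (fun ζ : disk => env s φ ζ -
      (M - env s φ ζ) / (1 - ‖(ζ : ℂ)‖) * ‖(η : ℂ) - ζ‖) (𝓝 η) (𝓝 (env s φ η)) := by
    have hne : 1 - ‖(η : ℂ)‖ ≠ 0 := by linarith [mem_disk.1 η.2]
    have h1 : ContinuousAt (fun ζ : disk => 1 - ‖(ζ : ℂ)‖) η := by fun_prop
    have h2 : ContinuousAt (fun ζ : disk => ‖(η : ℂ) - ζ‖) η := by fun_prop
    have hct : ContinuousAt (fun ζ : disk => env s φ ζ -
        (M - env s φ ζ) / (1 - ‖(ζ : ℂ)‖) * ‖(η : ℂ) - ζ‖) η :=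
      henv.sub (((continuousAt_const.sub henv).div h1 hne).mul h2)
    simpa [ContinuousAt] using hct
  have hevK : ∀ c < env s φ η, ∀ᶠ ζ in 𝓝 η, m ζ ∈ {σ | Below s φ σ ∧ c ≤ aff s σ η} :=
    fun c hc => (hlim.eventually (lt_mem_nhds hc)).mono
      fun ζ h => ⟨(hm ζ).1, h.le.trans (hlow ζ)⟩
  have hmt : Tendsto m (𝓝 η) (𝓝 (m η)) := by
    refine (isCompact_below (s := s) hφ η.2 (env s φ η - 1)).tendsto_nhds_of_unique_mapClusterPt
      (hevK _ (by linarith)) fun σ hσ hcl => huniq σ ?_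
    have hle : env s φ η ≤ aff s σ η := by
      by_contra! hlt
      obtain ⟨c, hc1, hc2⟩ := exists_between hlt
      have hopen : {τ : Mink | aff s τ η < c} ∈ 𝓝 σ :=
        (isOpen_lt (continuous_aff_left s (η : ℂ)) continuous_const).mem_nhds hc1
      obtain ⟨ζ, h1, h2⟩ := ((hcl.frequently hopen).and_eventually (hevK c hc2)).exists
      exact h2.2.not_gt h1
    exact (supp_iff hφ η.2).2 ⟨hσ.1, (hσ.1.aff_le_env hφ η.2).antisymm hle⟩
  have hpair : ContinuousAt (fun ζ : disk => (m ζ, (ζ : ℂ))) η :=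
    ContinuousAt.prodMk hmt continuous_subtype_val.continuousAt
  have hEt : E = (fun p : Mink × ℂ => killing p.1 p.2) ∘ fun ζ : disk => (m ζ, (ζ : ℂ)) := funext hE
  rw [hEt]
  exact continuous_killing.continuousAt.comp hpair

end InfEarthquake

namespace InfEarthquake

variable {s : Side} {φ : Circle → ℝ}

/-! ### Uniqueness -/

theorem IsInfEarthquake.exists_comparison {L : Set Geodesic} {E : disk → ℂ}
    (h : IsInfEarthquake s L E) : ∃ κ : Set ℂ → Mink,
      (∀ S, IsStratum L S → ∀ η : disk, (η : ℂ) ∈ S → E η = killing (κ S) η) ∧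
      (∀ S S', IsStratum L S → IsStratum L S' → ∀ η ∈ S, aff s (κ S') η ≤ aff s (κ S) η) ∧
      ∀ S S', IsStratum L S → IsStratum L S' → κ S = κ S' →
        ∃ T, IsStratum L T ∧ S ⊆ closure T ∧ S' ⊆ closure T := by
  obtain ⟨κ, hκ, hcomp⟩ := h
  refine ⟨κ, hκ, fun S S' hS hS' η hη => ?_, fun S S' hS hS' he =>
    (hcomp S S' hS hS').1 (sub_eq_zero.2 he.symm)⟩
  by_cases h0 : κ S' - κ S = 0
  · rw [sub_eq_zero.1 h0]
  · obtain ⟨h1, h2, h3⟩ := (hcomp S S' hS hS').2 h0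
    have := (h3.nonpos_and_nonneg h1 h2 hS.subset_disk hS'.subset_disk hS.nonempty
      hS'.nonempty).1 η hη
    rw [aff_sub] at this
    linarith

/-- If the normal field of a family of supporting affine functions of `v` extends continuously to
the circle, then so does `v`. -/
theorem tendsto_of_tendsto_normalField {v : ℂ → ℝ} {m : ℂ → Mink}
    (hv : ∀ η ∈ disk, v η = aff s (m η) η) (hle : ∀ η ∈ disk, ∀ ζ ∈ disk, aff s (m η) ζ ≤ v ζ)
    (z : Circle) (hY : Tendsto (fun η => normalField s (m η) η) (𝓝[disk] (z : ℂ))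
      (𝓝 (φ z • (z : ℂ)))) : Tendsto v (𝓝[disk] (z : ℂ)) (𝓝 (φ z)) := by
  have h0d : (0 : ℂ) ∈ disk := by simp [mem_disk]
  have hid : Tendsto (fun η : ℂ => η) (𝓝[disk] (z : ℂ)) (𝓝 (z : ℂ)) :=
    tendsto_id.mono_left nhdsWithin_le_nhds
  have hnorm : Tendsto (fun η : ℂ => ‖η‖) (𝓝[disk] (z : ℂ)) (𝓝 1) := by
    simpa only [z.norm_coe] using hid.norm
  have hzz : inner ℝ (φ z • (z : ℂ)) (z : ℂ) = φ z := by
    rw [real_inner_smul_left, real_inner_self_eq_norm_sq, z.norm_coe]; ring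
  have hY' (η w : ℂ) (hη : η ∈ disk) : inner ℝ (normalField s (m η) η) w =
      (1 - ‖η‖ ^ 2) * inner ℝ (grad s (m η)) w + v η * inner ℝ η w := by
    rw [normalField, inner_add_left, real_inner_smul_left, real_inner_smul_left, hv η hη]
  -- Comparing with the value at 0 gives ⟨∇, η⟩ ≥ v(η) - v(0), hence v(η) ≤ ⟨Y, η⟩ + (1 - |η|²)v(0)
  -- for the normal field Y.
  have hupper : ∀ ε > 0, ∀ᶠ η in 𝓝[disk] (z : ℂ), v η < φ z + ε := by
    intro ε hε
    have hlim : Tendsto (fun η => inner ℝ (normalField s (m η) η) η + (1 - ‖η‖ ^ 2) * v 0)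
        (𝓝[disk] (z : ℂ)) (𝓝 (φ z)) := by
      have := (hY.inner hid).add (((hnorm.pow 2).const_sub 1).mul_const (v 0))
      rw [hzz] at this
      simpa using this
    filter_upwards [hlim.eventually (gt_mem_nhds (lt_add_of_pos_right _ hε)), self_mem_nhdsWithin]
      with η hη hηd
    have h1 := hle η hηd 0 h0d
    rw [aff_eq_add s (m η) η, ← hv η hηd, zero_sub, inner_neg_right] at h1
    rw [hY' η η hηd, real_inner_self_eq_norm_sq] at hη
    have h2 : 0 ≤ 1 - ‖η‖ ^ 2 := by nlinarith [mem_disk.1 hηd, norm_nonneg η]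
    nlinarith [mul_nonneg h2 (by linarith : 0 ≤ inner ℝ (grad s (m η)) η - (v η - v 0))]
  -- A self-improving lower bound. With r = |ζ|, the supporting function at rζ is evaluated at ζ and
  -- its slope is eliminated through Y(rζ). The weight of v(rζ) is (1 + r + r²) / ((1 + r)(1 + r²)),
  -- which tends to 3/4, and ⟨Y(rζ), ζ⟩ gets a weight tending to 1/4.
  have hstep : ∀ c, (∀ᶠ η in 𝓝[disk] (z : ℂ), c ≤ v η) → ∀ ε > 0,
      ∀ᶠ η in 𝓝[disk] (z : ℂ), 3 / 4 * c + φ z / 4 - ε ≤ v η := by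
    intro c hc ε hε
    have hN : Tendsto (fun ζ : ℂ => ‖ζ‖ • ζ) (𝓝[disk] (z : ℂ)) (𝓝[disk] (z : ℂ)) := by
      refine tendsto_nhdsWithin_iff.2 ⟨by simpa using hnorm.smul hid, ?_⟩
      filter_upwards [self_mem_nhdsWithin] with ζ hζ
      rw [mem_disk] at hζ ⊢
      rw [norm_smul, norm_norm]
      nlinarith [norm_nonneg ζ]
    have hlim : Tendsto (fun ζ : ℂ => (c * (1 + ‖ζ‖ + ‖ζ‖ ^ 2) +
        inner ℝ (normalField s (m (‖ζ‖ • ζ)) (‖ζ‖ • ζ)) ζ) / ((1 + ‖ζ‖) * (1 + ‖ζ‖ ^ 2)))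
        (𝓝[disk] (z : ℂ)) (𝓝 (3 / 4 * c + φ z / 4)) := by
      have h1 := (((hnorm.const_add 1).add (hnorm.pow 2)).const_mul c).add
        ((hY.comp hN).inner hid)
      have h2 := (hnorm.const_add 1).mul ((hnorm.pow 2).const_add 1)
      have h3 := h1.div h2 (by norm_num)
      rw [hzz] at h3
      have e : (c * (1 + 1 + 1 ^ 2) + φ z) / ((1 + 1) * (1 + 1 ^ 2)) = 3 / 4 * c + φ z / 4 := by
        ring
      rw [e] at h3
      exact h3
    filter_upwards [hlim.eventually (lt_mem_nhds (sub_lt_self _ hε)), self_mem_nhdsWithin,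
      hN.eventually hc, hN.eventually self_mem_nhdsWithin] with ζ h1 hζ hcζ hη
    refine h1.le.trans ?_
    set r := ‖ζ‖ with hr
    have hr0 : 0 ≤ r := norm_nonneg ζ
    have hr1 : r < 1 := mem_disk.1 hζ
    rw [div_le_iff₀ (by positivity), hY' _ _ hη, norm_smul, norm_norm, ← hr, real_inner_smul_left,
      real_inner_self_eq_norm_sq, ← hr]
    have h2 := hle _ hη _ hζ
    have e : ζ - r • ζ = (1 - r) • ζ := by module
    rw [aff_eq_add s _ (r • ζ) ζ, ← hv _ hη, e, inner_smul_right] at h2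
    set g := inner ℝ (grad s (m (r • ζ))) ζ
    set u := v (r • ζ)
    have h3 : (u + (1 - r) * g) * ((1 + r) * (1 + r ^ 2)) ≤ v ζ * ((1 + r) * (1 + r ^ 2)) := by
      gcongr
    have h4 : c * (1 + r + r ^ 2) ≤ u * (1 + r + r ^ 2) := by gcongr
    have h5 : (u + (1 - r) * g) * ((1 + r) * (1 + r ^ 2)) =
        u * (1 + r + r ^ 2) + ((1 - (r * r) ^ 2) * g + u * (r * r ^ 2)) := by ring
    linarith
  have hlower : ∀ ε > 0, ∀ᶠ η in 𝓝[disk] (z : ℂ), φ z - 5 * ε < v η := by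
    intro ε hε
    set c₀ := aff s (m 0) z - 1 with hc₀
    -- The fixed point of c ↦ 3c/4 + φ(z)/4 - ε, to which the iterated bounds converge.
    set l := φ z - 4 * ε with hl
    have hbase : ∀ᶠ η in 𝓝[disk] (z : ℂ), c₀ ≤ v η := by
      have := ((continuous_aff_right s (m 0)).tendsto (z : ℂ)).mono_left
        (nhdsWithin_le_nhds (s := disk))
      filter_upwards [this.eventually (lt_mem_nhds (sub_lt_self _ one_pos)), self_mem_nhdsWithin]
        with η h hη
      exact h.le.trans (hle 0 h0d η hη)
    have hiter : ∀ n : ℕ, ∀ᶠ η in 𝓝[disk] (z : ℂ), l + (3 / 4) ^ n * (c₀ - l) ≤ v η := by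
      intro n
      induction n with
      | zero => simpa using hbase
      | succ n ih =>
        refine (hstep _ ih ε hε).mono fun η h => le_trans (le_of_eq ?_) h
        rw [pow_succ, hl]; ring
    have hlim : Tendsto (fun n : ℕ => l + (3 / 4 : ℝ) ^ n * (c₀ - l)) atTop (𝓝 l) := by
      have := ((tendsto_pow_atTop_nhds_zero_of_lt_one (by norm_num) (by norm_num) :
        Tendsto (fun n : ℕ => (3 / 4 : ℝ) ^ n) atTop (𝓝 0)).mul_const (c₀ - l)).const_add l
      simpa using this
    obtain ⟨n, hn⟩ := (hlim.eventually (lt_mem_nhds (sub_lt_self l hε))).exists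
    refine (hiter n).mono fun η h => lt_of_lt_of_le ?_ h
    linarith
  rw [Metric.tendsto_nhds]
  intro ε hε
  filter_upwards [hupper ε hε, hlower (ε / 5) (by positivity)] with η h1 h2
  rw [Real.dist_eq, abs_lt]
  constructor <;> linarith

/-- A stratum-wise affine convex function with boundary values `φ` is the envelope of `φ`. -/
theorem env_le_of_stratified {L : Set Geodesic} (hL : IsClosed L) (hφ : Continuous φ) {v : ℂ → ℝ}
    {κ : Set ℂ → Mink} (hcont : ContinuousOn v disk)
    (hv : ∀ S, IsStratum L S → ∀ η ∈ S, aff s (κ S) η = v η)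
    (hlim : ∀ z : Circle, Tendsto v (𝓝[disk] (z : ℂ)) (𝓝 (φ z))) {η : ℂ} (hη : η ∈ disk) :
    env s φ η ≤ v η := by
  -- On a leaf v interpolates φ linearly between the endpoints, and every affine function below φ is
  -- at most that.
  have hleaf : ∀ x ∈ locus L, env s φ x ≤ v x := by
    intro x hx
    obtain ⟨l, hl, hxl⟩ := mem_locus.1 hx
    have h1 := hv l.carrier (Or.inl ⟨l, hl, rfl⟩)
    obtain ⟨p, q, hpq, rfl⟩ := l.exists_mk
    obtain ⟨hp, hq⟩ := aff_eq_of_eqOn_openSegment hpq hlim h1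
    obtain ⟨σ, hσ⟩ := exists_supp (s := s) hφ (openSegment_circle_subset_disk hpq hxl)
    rw [hσ.env_eq, ← h1 x hxl]
    obtain ⟨a, b, ha, hb, hab, rfl⟩ := hxl
    rw [aff_combo s _ hab, aff_combo s _ hab, hp, hq]
    exact add_le_add (mul_le_mul_of_nonneg_left (hσ.1 p) ha.le)
      (mul_le_mul_of_nonneg_left (hσ.1 q) hb.le)
  by_cases hηL : η ∈ locus L
  · exact hleaf η hηL
  set G := connectedComponentIn (disk \ locus L) η with hG
  have hGs : IsStratum L G := Or.inr ⟨η, ⟨hη, hηL⟩, rfl⟩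
  have hηG : η ∈ G := mem_connectedComponentIn ⟨hη, hηL⟩
  obtain ⟨σ, hσ⟩ := exists_supp (s := s) hφ hη
  set τ := κ G
  rw [hσ.env_eq, ← hv G hGs η hηG]
  by_contra! hlt
  -- Leave the gap along a ray on which the excess of σ over τ does not decrease. At the exit point,
  -- on a leaf or on the circle, τ has the value of v or φ, which is at least that of σ.
  obtain ⟨e, hen, he⟩ : ∃ e : ℂ, ‖e‖ = 1 ∧ 0 ≤ inner ℝ (grad s (σ - τ)) e := by
    rcases le_total 0 (inner ℝ (grad s (σ - τ)) (1 : ℂ)) with h | h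
    · exact ⟨1, by simp, h⟩
    · exact ⟨-1, by simp, by rw [inner_neg_right]; linarith⟩
  let x : ℝ → ℂ := fun t => η + t • e
  have hx : Continuous x := by fun_prop
  have hpos : ∀ t, 0 ≤ t → aff s τ (x t) < aff s σ (x t) := by
    intro t ht
    have h1 := aff_eq_add s (σ - τ) η (x t)
    have h2 : x t - η = t • e := add_sub_cancel_left _ _
    rw [h2, inner_smul_right, aff_sub, aff_sub] at h1
    linarith [mul_nonneg ht he]
  obtain ⟨K, hK, hKL⟩ := exists_isCompact_locus hL
  have hcpt : IsCompact {t | t ∈ Icc (0 : ℝ) 2 ∧ x t ∈ K ∪ diskᶜ} :=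
    isCompact_Icc.inter_right ((hK.isClosed.union isOpen_disk.isClosed_compl).preimage hx)
  have hne : {t | t ∈ Icc (0 : ℝ) 2 ∧ x t ∈ K ∪ diskᶜ}.Nonempty := by
    refine ⟨2, ⟨by norm_num, le_rfl⟩, Or.inr fun h => ?_⟩
    rw [mem_disk] at h hη
    have h1 := norm_sub_le (x 2) η
    have h2 : x 2 - η = (2 : ℝ) • e := add_sub_cancel_left _ _
    rw [h2, norm_smul, hen, Real.norm_ofNat] at h1
    linarith
  obtain ⟨t, ⟨⟨ht0, ht2⟩, htK⟩, hmin⟩ := hcpt.exists_isLeast hne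
  have hbefore : ∀ u, 0 ≤ u → u < t → x u ∈ disk \ locus L := by
    intro u hu hut
    have h1 : x u ∉ K ∪ diskᶜ := fun h => hut.not_ge (hmin ⟨⟨hu, hut.le.trans ht2⟩, h⟩)
    rw [mem_union, not_or, notMem_compl_iff] at h1
    exact ⟨h1.2, fun h => h1.1 (hKL ▸ h : x u ∈ disk ∩ K).2⟩
  have hx0 : x 0 = η := by simp [x]
  have htpos : 0 < t := by
    refine ht0.lt_of_ne ?_
    rintro rfl
    rw [hx0] at htK
    rcases htK with h | h
    · exact hηL (hKL ▸ ⟨hη, h⟩)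
    · exact h hη
  have hxG : ∀ u ∈ Ico 0 t, x u ∈ G := by
    have hpre : IsPreconnected (x '' Ico 0 t) := isPreconnected_Ico.image x hx.continuousOn
    have hsub := hpre.subset_connectedComponentIn (x := η) (F := disk \ locus L)
      ⟨0, ⟨le_rfl, htpos⟩, hx0⟩ (by rintro _ ⟨u, hu, rfl⟩; exact hbefore u hu.1 hu.2)
    exact fun u hu => hsub ⟨u, hu, rfl⟩
  have hev : ∀ᶠ u in 𝓝[<] t, u ∈ Ico 0 t :=
    (Ioo_mem_nhdsLT htpos : Ioo 0 t ∈ 𝓝[<] t) |> fun h => mem_of_superset h Ioo_subset_Ico_self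
  have hxt : Tendsto x (𝓝[<] t) (𝓝 (x t)) := (hx.tendsto t).mono_left nhdsWithin_le_nhds
  have hxd : Tendsto x (𝓝[<] t) (𝓝[disk] (x t)) := tendsto_nhdsWithin_iff.2
    ⟨hxt, hev.mono fun u hu => (hbefore u hu.1 hu.2).1⟩
  have hval : ∀ y : ℝ, Tendsto v (𝓝[disk] (x t)) (𝓝 y) → aff s τ (x t) = y := by
    intro y hy
    refine tendsto_nhds_unique (((continuous_aff_right s τ).tendsto _).comp hxt)
      ((hy.comp hxd).congr' ?_)
    filter_upwards [hev] with u hu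
    exact (hv G hGs _ (hxG u hu)).symm
  by_cases hd : x t ∈ disk
  · have hxL : x t ∈ locus L := hKL ▸ ⟨hd, htK.resolve_right fun h => h hd⟩
    have h1 := hval _ (hcont _ hd)
    have h2 := hleaf _ hxL
    have h3 := hσ.1.aff_le_env hφ hd
    linarith [hpos t ht0]
  · have hn : ‖x t‖ = 1 := by
      refine le_antisymm ?_ (not_lt.1 fun h => hd (mem_disk.2 h))
      exact le_of_tendsto hxt.norm (hev.mono fun u hu => (mem_disk.1 (hbefore u hu.1 hu.2).1).le)
    obtain ⟨z, hz⟩ : ∃ z : Circle, (z : ℂ) = x t :=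
      ⟨⟨x t, by simpa [Submonoid.unitSphere] using hn⟩, rfl⟩
    have h1 := hval (φ z) (hz ▸ hlim z)
    have h2 := hσ.1 z
    rw [hz] at h2
    linarith [hpos t ht0]

/-- If a leaf entered the flat part, strata on its two sides would share one vector. The clause on
vanishing comparison fields would put both in the closure of a single stratum, which being connected
would have to cross the leaf. -/
theorem disjoint_flatPart_of_mem {L : Set Geodesic} (hL : IsLamination L) {κ : Set ℂ → Mink}
    (hsupp : ∀ S, IsStratum L S → ∀ η ∈ S, Supp s φ (κ S) η)
    (hκ : ∀ S S', IsStratum L S → IsStratum L S' → κ S = κ S' →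
      ∃ T, IsStratum L T ∧ S ⊆ closure T ∧ S' ⊆ closure T) {l : Geodesic} (hl : l ∈ L) :
    Disjoint l.carrier (flatPart s φ) := by
  rw [Set.disjoint_left]
  intro η hη hηf
  obtain ⟨σ, hσ⟩ := mem_flatPart.1 hηf
  obtain ⟨p, q, hpq, rfl⟩ := l.exists_mk
  set f := chordFun (p : ℂ) q with hf
  set n : ℂ := Complex.I * ((q : ℂ) - p) with hn
  have hpath : Continuous fun t : ℝ => η + t • n := by fun_prop
  have hft : ∀ t : ℝ, f (η + t • n) =
      t * (((q : ℂ).re - (p : ℂ).re) ^ 2 + ((q : ℂ).im - (p : ℂ).im) ^ 2) := by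
    intro t
    have h0 := chordFun_eq_zero hη
    simp only [chordFun, area, Complex.sub_re, Complex.sub_im] at h0
    simp [hf, chordFun, area, hn]
    linear_combination h0
  have hN := normSq_sub_pos (Circle.coe_injective.ne hpq)
  have hnear : ∀ᶠ t in 𝓝 (0 : ℝ), η + t • n ∈ interior (zone s φ σ) :=
    hpath.continuousAt.eventually_mem (by simpa using isOpen_interior.mem_nhds hσ)
  have hstrat : ∀ t : ℝ, η + t • n ∈ interior (zone s φ σ) →
      ∃ S, IsStratum L S ∧ η + t • n ∈ S ∧ κ S = σ := by
    intro t ht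
    obtain ⟨S, hS, hmem⟩ := exists_isStratum L (interior_subset ht).1
    exact ⟨S, hS, hmem, (hsupp S hS _ hmem).eq_of_mem_interior ht⟩
  obtain ⟨t, ht, htpos⟩ := ((hnear.filter_mono nhdsWithin_le_nhds).and
    (self_mem_nhdsWithin : Ioi (0 : ℝ) ∈ 𝓝[>] 0)).exists
  obtain ⟨u, hu, huneg⟩ := ((hnear.filter_mono nhdsWithin_le_nhds).and
    (self_mem_nhdsWithin : Iio (0 : ℝ) ∈ 𝓝[<] 0)).exists
  obtain ⟨S, hS, hmem, hκS⟩ := hstrat t ht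
  obtain ⟨S', hS', hmem', hκS'⟩ := hstrat u hu
  obtain ⟨T, hT, hST, hST'⟩ := hκ S S' hS hS' (hκS.trans hκS'.symm)
  have hfc : Continuous f := continuous_chordFun _ _
  obtain ⟨x, hx, hxT⟩ := mem_closure_iff.1 (hST hmem) {w | 0 < f w}
    (isOpen_lt continuous_const hfc) (by rw [mem_ofPred_eq, hft]; exact mul_pos htpos hN)
  obtain ⟨y, hy, hyT⟩ := mem_closure_iff.1 (hST' hmem') {w | f w < 0}
    (isOpen_lt hfc continuous_const)
    (by rw [mem_ofPred_eq, hft]; exact mul_neg_of_neg_of_pos huneg hN)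
  obtain ⟨w, hwT, hw0⟩ := hT.isPreconnected.intermediate_value hyT hxT hfc.continuousOn
    (⟨le_of_lt hy, le_of_lt hx⟩ : (0 : ℝ) ∈ Icc (f y) (f x))
  have hwl : w ∈ (Geodesic.mk hpq).carrier :=
    mem_openSegment_of_chordFun_eq_zero hpq (hT.subset_disk hwT) hw0
  obtain ⟨l', hl', rfl⟩ | hG := hT
  · have hll : Geodesic.mk hpq = l' := by
      by_contra hne
      exact Set.disjoint_left.1 (hL.2 hl hl' hne) hwl hwT
    rw [← hll] at hxT
    exact (ne_of_gt hx) (chordFun_eq_zero hxT)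
  · exact (hG.subset hwT).2 (mem_locus.2 ⟨_, hl, hwl⟩)

theorem eq_bending_and_adapted {X : Circle → ℂ} (hX : Continuous X) (hT : IsTangent X)
    {L : Set Geodesic} {E : disk → ℂ} (hL : IsLamination L) (hE : IsInfEarthquake s L E)
    (hEX : ExtendsTo E X) : L = bending s (bd s X) ∧ Adapted s (bd s X) E := by
  have hφ := continuous_bd hX s
  obtain ⟨κ, hEκ, hcomp, hclos⟩ := hE.exists_comparison
  choose! St hSt hmemSt using fun η (hη : η ∈ disk) => exists_isStratum L hη
  set m : ℂ → Mink := fun η => κ (St η) with hm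
  set v : ℂ → ℝ := fun η => aff s (m η) η with hv
  have hle : ∀ S, IsStratum L S → ∀ ζ ∈ disk, aff s (κ S) ζ ≤ v ζ := fun S hS ζ hζ =>
    hcomp (St ζ) S (hSt ζ hζ) hS ζ (hmemSt ζ hζ)
  have heq : ∀ S, IsStratum L S → ∀ η ∈ S, aff s (κ S) η = v η := fun S hS η hη =>
    (hle S hS η (hS.subset_disk hη)).antisymm
      (hcomp S (St η) hS (hSt η (hS.subset_disk hη)) η hη)
  have hlem : ∀ η ∈ disk, ∀ ζ ∈ disk, aff s (m η) ζ ≤ v ζ := fun η hη => hle _ (hSt η hη)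
  have hEm : ∀ η : disk, E η = killing (m η) η := fun η => hEκ _ (hSt η η.2) η (hmemSt η η.2)
  have hlim : ∀ z : Circle, Tendsto v (𝓝[disk] (z : ℂ)) (𝓝 (bd s X z)) := fun z =>
    tendsto_of_tendsto_normalField (fun _ _ => rfl) hlem z ((extendsTo_iff hT s hEm).1 hEX z)
  have hbelow : ∀ S, IsStratum L S → Below s (bd s X) (κ S) := by
    intro S hS z
    have hcl : (z : ℂ) ∈ closure disk := by
      rw [disk, closure_ball _ one_ne_zero, mem_closedBall_zero_iff, z.norm_coe]
    have := mem_closure_iff_nhdsWithin_neBot.1 hcl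
    refine le_of_tendsto_of_tendsto (((continuous_aff_right s (κ S)).tendsto (z : ℂ)).mono_left
      nhdsWithin_le_nhds) (hlim z) ?_
    filter_upwards [self_mem_nhdsWithin] with η hη
    exact hle S hS η hη
  have hcont : ContinuousOn v disk :=
    (convexOn_of_support (fun _ _ => rfl) hlem).continuousOn isOpen_disk
  have hsupp : ∀ S, IsStratum L S → ∀ η ∈ S, Supp s (bd s X) (κ S) η := by
    intro S hS η hη
    have hηd := hS.subset_disk hη
    refine (supp_iff hφ hηd).2 ⟨hbelow S hS, ((hbelow S hS).aff_le_env hφ hηd).antisymm ?_⟩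
    rw [heq S hS η hη]
    exact env_le_of_stratified hL.1 hφ hcont heq hlim hηd
  have hsub : L ⊆ bending s (bd s X) := fun l hl =>
    ⟨⟨κ l.carrier, hsupp _ (Or.inl ⟨l, hl, rfl⟩)⟩, disjoint_flatPart_of_mem hL hsupp hclos hl⟩
  have hLeq : L = bending s (bd s X) := by
    refine hsub.antisymm fun l hl => ?_
    obtain ⟨η, hη⟩ := l.carrier_nonempty
    have hηd := l.carrier_subset_disk hη
    by_cases hηL : η ∈ locus L
    · obtain ⟨l', hl', hη'⟩ := mem_locus.1 hηL
      rwa [eq_of_mem_bending hφ hl (hsub hl') hη hη']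
    · have hG : IsGap L (connectedComponentIn (disk \ locus L) η) := ⟨η, ⟨hηd, hηL⟩, rfl⟩
      -- A gap of L is open and lies in the zone of its vector, so it is flat and no leaf of
      -- `bending` can meet it.
      refine absurd (mem_flatPart.2 ⟨κ (connectedComponentIn (disk \ locus L) η), ?_⟩)
        (Set.disjoint_left.1 hl.2 hη)
      have hz : connectedComponentIn (disk \ locus L) η ⊆
          zone s (bd s X) (κ (connectedComponentIn (disk \ locus L) η)) :=
        fun ζ hζ => ⟨(hG.subset hζ).1, hsupp _ (Or.inr hG) ζ hζ⟩
      exact interior_maximal hz (hG.isOpen hL.1) (mem_connectedComponentIn ⟨hηd, hηL⟩)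
  refine ⟨hLeq, fun S hS => ⟨κ S, fun η hη => ?_⟩⟩
  rw [← hLeq] at hS
  exact ⟨hsupp S hS η hη, hEκ S hS η hη⟩

end InfEarthquake

/-! ### Axes of leaf differences, medial choice and the main theorem -/

namespace InfEarthquake

variable {s : Side} {φ : Circle → ℝ}

theorem supp_eq_of_mem_stratum (hφ : Continuous φ) {S : Set ℂ} (hS : IsStratum (bending s φ) S)
    {η ζ : ℂ} (hη : η ∈ S) (hζ : ζ ∈ S) : {σ | Supp s φ σ η} = {σ | Supp s φ σ ζ} :=
  Set.ext fun _ => ⟨fun h => h.of_mem_stratum hφ hS hη hζ, fun h => h.of_mem_stratum hφ hS hζ hη⟩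

theorem leafSupport_eq {X : Circle → ℂ} (hX : Continuous X) {l : Geodesic}
    (hl : l ∈ bending s (bd s X)) {η : ℂ} (hη : η ∈ l.carrier) :
    leafSupport s X l = {σ | Supp s (bd s X) σ η} := by
  ext σ
  simp only [leafSupport, mem_ofPred_eq, isSupportPlane_iff]
  exact ⟨fun h => h η hη, fun h ζ hζ => h.of_mem_carrier (continuous_bd hX s) hl hη hζ⟩

theorem axis_sub_eq_carrier (hφ : Continuous φ) {l : Geodesic} {σ₁ σ₂ : Mink}
    (h₁ : ∀ η ∈ l.carrier, Supp s φ σ₁ η) (h₂ : ∀ η ∈ l.carrier, Supp s φ σ₂ η) (hne : σ₁ ≠ σ₂) :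
    axis (σ₂ - σ₁) = l.carrier := by
  obtain ⟨p, q, hpq, rfl⟩ := l.exists_mk
  obtain ⟨-, hp₁, hq₁⟩ := (supp_carrier_iff hφ hpq).1 h₁
  obtain ⟨-, hp₂, hq₂⟩ := (supp_carrier_iff hφ hpq).1 h₂
  obtain ⟨c, hc⟩ := exists_aff_eq_mul_chordFun (s := s) (τ := σ₂ - σ₁)
    (Circle.coe_injective.ne hpq) (by rw [aff_sub, hp₁, hp₂, sub_self])
    (by rw [aff_sub, hq₁, hq₂, sub_self])
  have hc0 : c ≠ 0 := by
    rintro rfl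
    exact hne (sub_eq_zero.1 (eq_zero_of_aff_eq_zero (s := s) fun w => by rw [hc, zero_mul])).symm
  ext η
  rw [axis, mem_ofPred_eq, ← aff_eq_zero_iff s, hc, mul_eq_zero, or_iff_right hc0]
  exact ⟨fun h => mem_openSegment_of_chordFun_eq_zero hpq h.1 h.2,
    fun h => ⟨openSegment_circle_subset_disk hpq h, chordFun_eq_zero h⟩⟩

/-- The choice depends on the set alone, so points of one stratum, which have the same support
planes, receive the same vector. -/
theorem exists_midpoint_selection : ∃ mid : Set Mink → Mink, ∀ W : Set Mink,
    (∃ σ₁ σ₂, W = segment ℝ σ₁ σ₂) → ∃ σ₁ σ₂, W = segment ℝ σ₁ σ₂ ∧ mid W = midpoint ℝ σ₁ σ₂ := by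
  have h : ∀ W : Set Mink, ∃ σ, (∃ σ₁ σ₂, W = segment ℝ σ₁ σ₂) →
      ∃ σ₁ σ₂, W = segment ℝ σ₁ σ₂ ∧ σ = midpoint ℝ σ₁ σ₂ := by
    intro W
    by_cases hW : ∃ σ₁ σ₂, W = segment ℝ σ₁ σ₂
    · obtain ⟨σ₁, σ₂, h⟩ := hW
      exact ⟨midpoint ℝ σ₁ σ₂, fun _ => ⟨σ₁, σ₂, h, rfl⟩⟩
    · exact ⟨0, fun h => absurd h hW⟩
  choose mid hmid using h
  exact ⟨mid, hmid⟩

end InfEarthquake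

open InfEarthquake
theorem theorem1p1 (X : Circle → ℂ) (hX : Continuous X) (hT : IsTangent X) (s : Side) :
    ∃ (L : Set Geodesic) (E : disk → ℂ),
      -- existence, and the construction by medial support planes
      IsLamination L ∧ IsInfEarthquake s L E ∧ ExtendsTo E X ∧
      (∀ η : disk, ∃ σ, IsMedialSupportPlane s X η σ ∧ E η = killing σ η) ∧
      -- uniqueness, up to the choice of a support plane for each leaf of discontinuity
      (∀ (L₁ : Set Geodesic) (E₁ : disk → ℂ),
        (IsLamination L₁ ∧ IsInfEarthquake s L₁ E₁ ∧ ExtendsTo E₁ X) ↔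
          (L₁ = L ∧
            (∀ G, IsGap L G → ∀ η : disk, (η : ℂ) ∈ G → E₁ η = E η) ∧
            (∀ l ∈ L, ContinuousAlong E l → ∀ η : disk, (η : ℂ) ∈ l.carrier → E₁ η = E η) ∧
            (∀ l ∈ L, ¬ ContinuousAlong E l →
              ∃ σ ∈ leafSupport s X l, ∀ η : disk, (η : ℂ) ∈ l.carrier → E₁ η = killing σ η))) ∧
      -- the range of choices on a leaf of discontinuity is a nondegenerate segment
      (∀ l ∈ L, ¬ ContinuousAlong E l →
        ∃ σ₁ σ₂ : Mink, σ₁ ≠ σ₂ ∧ IsHyperbolic (σ₂ - σ₁) ∧ axis (σ₂ - σ₁) = l.carrier ∧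
          leafSupport s X l = segment ℝ σ₁ σ₂) := by
  have hφ := continuous_bd hX s
  obtain ⟨mid, hmid⟩ := exists_midpoint_selection
  set m : disk → Mink := fun η => mid {σ | Supp s (bd s X) σ η} with hm
  set E : disk → ℂ := fun η => killing (m η) η with hE
  have hmid' (η : disk) := hmid _ (exists_supp_eq_segment (s := s) hφ η.2)
  have hmS (η : disk) : Supp s (bd s X) (m η) η := by
    obtain ⟨σ₁, σ₂, h1, h2⟩ := hmid' η
    have : m η ∈ {σ | Supp s (bd s X) σ η} := by
      rw [h1, show m η = _ from h2]
      exact midpoint_mem_segment σ₁ σ₂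
    exact this
  have hEm (η : disk) : E η = killing (m η) η := rfl
  have hmeq {S : Set ℂ} (hS : IsStratum (bending s (bd s X)) S) {η ζ : disk} (hη : (η : ℂ) ∈ S)
      (hζ : (ζ : ℂ) ∈ S) : m η = m ζ := congrArg mid (supp_eq_of_mem_stratum hφ hS hη hζ)
  have hadapt : Adapted s (bd s X) E := by
    intro S hS
    obtain ⟨ζ, hζ⟩ := hS.nonempty
    refine ⟨m ⟨ζ, hS.subset_disk hζ⟩, fun η hη => ?_⟩
    rw [← hmeq hS (η := η) (ζ := ⟨ζ, hS.subset_disk hζ⟩) hη hζ]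
    exact ⟨hmS η, rfl⟩
  refine ⟨bending s (bd s X), E, isLamination_bending hφ, hadapt.isInfEarthquake hφ,
    hadapt.extendsTo hX hT, fun η => ?_, fun L₁ E₁ => ⟨?_, ?_⟩, ?_⟩
  · obtain ⟨σ₁, σ₂, h1, h2⟩ := hmid' η
    refine ⟨m η, ⟨σ₁, σ₂, ?_, h2⟩, rfl⟩
    simp only [isSupportPlane_iff]
    exact h1
  · rintro ⟨hL₁, hE₁, hX₁⟩
    obtain ⟨rfl, had⟩ := eq_bending_and_adapted hX hT hL₁ hE₁ hX₁
    refine ⟨rfl, fun G hG η hη => ?_, fun l hl hc η hη => ?_, fun l hl hc => ?_⟩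
    · obtain ⟨σ, hσ⟩ := had G (Or.inr hG)
      obtain ⟨τ, rfl, -⟩ := (isGap_bending_iff hφ).1 hG
      rw [(hσ η hη).2, hEm, (hσ η hη).1.eq_of_mem_interior hη, (hmS η).eq_of_mem_interior hη]
    · obtain ⟨σ, hσ⟩ := had l.carrier (Or.inl ⟨l, hl, rfl⟩)
      rw [(hσ η hη).2, hEm, eq_of_continuousAt hφ hmS hEm (hc η hη) (hσ η hη).1]
    · obtain ⟨σ, hσ⟩ := had l.carrier (Or.inl ⟨l, hl, rfl⟩)
      exact ⟨σ, fun η hη => isSupportPlane_iff.2 (hσ ⟨η, l.carrier_subset_disk hη⟩ hη).1,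
        fun η hη => (hσ η hη).2⟩
  · rintro ⟨rfl, hgap, hcon, hdis⟩
    suffices had : Adapted s (bd s X) E₁ from
      ⟨isLamination_bending hφ, had.isInfEarthquake hφ, had.extendsTo hX hT⟩
    intro S hS
    obtain ⟨σ, hσ⟩ := hadapt S hS
    obtain ⟨l, hl, rfl⟩ | hG := id hS
    · by_cases hc : ContinuousAlong E l
      · exact ⟨σ, fun η hη => ⟨(hσ η hη).1, (hcon l hl hc η hη).trans (hσ η hη).2⟩⟩
      · obtain ⟨τ, hτ, hEτ⟩ := hdis l hl hc
        exact ⟨τ, fun η hη => ⟨isSupportPlane_iff.1 (hτ η hη), hEτ η hη⟩⟩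
    · exact ⟨σ, fun η hη => ⟨(hσ η hη).1, (hgap S hG η hη).trans (hσ η hη).2⟩⟩
  · intro l hl hc
    simp only [ContinuousAlong, not_forall] at hc
    obtain ⟨η, hη, hdisc⟩ := hc
    obtain ⟨σ₁, σ₂, hseg⟩ := exists_supp_eq_segment (s := s) hφ η.2
    have hmem₁ : Supp s (bd s X) σ₁ η := hseg.ge (left_mem_segment ℝ σ₁ σ₂)
    have hmem₂ : Supp s (bd s X) σ₂ η := hseg.ge (right_mem_segment ℝ σ₁ σ₂)
    have hne : σ₁ ≠ σ₂ := by
      rintro rfl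
      rw [segment_same] at hseg
      -- A degenerate segment would mean a unique support plane at η, hence continuity there.
      exact hdisc (continuousAt_of_forall_eq hφ hmS hEm fun σ hσ =>
        (hseg.le hσ : σ = σ₁).trans (hseg.le (hmS η) : m η = σ₁).symm)
    have hax := axis_sub_eq_carrier hφ (fun ζ hζ => hmem₁.of_mem_carrier hφ hl hη hζ)
      (fun ζ hζ => hmem₂.of_mem_carrier hφ hl hη hζ) hne
    refine ⟨σ₁, σ₂, hne, ?_, hax, (leafSupport_eq hX hl hη).trans hseg⟩
    exact isHyperbolic_of_mink_lift_eq_zero (sub_ne_zero.2 hne.symm) η.2 (hax.ge hη).2
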